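/- Let $K$ be a field, let $G$ be a finite simple graph and let $B$ be a block of $G$, i.e. an induced subgraph of $G$ that is maximal among the connected induced subgraphs without cut vertices. (A cut vertex of a graph is a vertex whose deletion increases the number of connected components.) Let $W\subseteq V(B)$ be any set of vertices of $B$, and let $\overline{B}$ be the graph obtained from $B$ by adding, for each $w\in W$, one new vertex $f_w$ and the single edge $\{w,f_w\}$; for instance, $W$ may be the set of all cut vertices of $G$ that lie in $B$. For a finite simple graph $H$ let $J_H=(x_iy_j-x_jy_i : \{i,j\}\in E(H))\subseteq K[x_v,y_v : v\in V(H)]$ be its binomial edge ideal; $J_H$ is called unmixed if all its minimal primes have the same height. A set $T\subseteq V(H)$ is a cutset of $H$ if each $t\in T$ is a cut vertex of $H\setminus(T\setminus\{t\})$. The graph $H$ is called accessible if $J_H$ is unmixed and every non-empty cutset $T$ of $H$ contains some $t$ such that $T\setminus\{t\}$ is again a cutset of $H$. If $\overline{B}$ is accessible and has exactly three cut vertices, then there is a cut vertex $v$ of $\overline{B}$ such that $J_{\overline{B}\setminus\{v\}}$ is unmixed. -/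

import Mathlib

/-!
Binomial edge ideals, unmixedness, cutsets, accessible graphs and blocks with whiskers.
All graphs are simple; the theorem uses these notions for finite graphs only.
-/

namespace BinomialEdge

/-- The binomial edge ideal `J_G = (x_i y_j - x_j y_i : {i, j} an edge of G)` in the polynomial ring
`K[x_v, y_v : v ∈ V(G)]`, where `x_v = X (Sum.inl v)` and `y_v = X (Sum.inr v)`.  As
`f_{ji} = -f_{ij}`, taking both orientations of each edge does not change the ideal. -/
noncomputable def binomialEdgeIdeal (K : Type*) [Field K] {V : Type*} (G : SimpleGraph V) :
    Ideal (MvPolynomial (V ⊕ V) K) :=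
  Ideal.span {f | ∃ i j : V, G.Adj i j ∧
    f = MvPolynomial.X (Sum.inl i) * MvPolynomial.X (Sum.inr j)
      - MvPolynomial.X (Sum.inl j) * MvPolynomial.X (Sum.inr i)}

/-- An ideal is unmixed if all its minimal primes have the same height. -/
def IsUnmixed {R : Type*} [CommRing R] (I : Ideal R) : Prop :=
  ∀ P ∈ I.minimalPrimes, ∀ Q ∈ I.minimalPrimes, P.height = Q.height

/-- The graph `G ∖ T`, that is, the subgraph of `G` induced on the complement of `T`. -/
abbrev deleteSet {V : Type*} (G : SimpleGraph V) (T : Set V) : SimpleGraph ↥Tᶜ :=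
  G.induce Tᶜ

/-- `c_G(T)`: the number of connected components of `G ∖ T` (for finite `G`). -/
noncomputable def numComponents {V : Type*} (G : SimpleGraph V) (T : Set V) : ℕ :=
  Nat.card (deleteSet G T).ConnectedComponent

/-- `v` is a cut vertex of `G`: deleting `v` increases the number of connected components. -/
def IsCutVertex {V : Type*} (G : SimpleGraph V) (v : V) : Prop :=
  Nat.card G.ConnectedComponent < Nat.card (deleteSet G {v}).ConnectedComponent

/-- `T` is a cutset of `G`: every `t ∈ T` is a cut vertex of `G ∖ (T ∖ {t})`.  Deleting `t` from
`G ∖ (T ∖ {t})` leaves `G ∖ T`, so this says `c_G(T ∖ {t}) < c_G(T)`. -/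
def IsCutset {V : Type*} (G : SimpleGraph V) (T : Set V) : Prop :=
  ∀ t ∈ T, numComponents G (T \ {t}) < numComponents G T

/-- `G` is accessible (over `K`): `J_G` is unmixed, and every non-empty cutset `T` of `G` has an
element `t` such that `T ∖ {t}` is again a cutset. -/
def IsAccessible (K : Type*) [Field K] {V : Type*} (G : SimpleGraph V) : Prop :=
  IsUnmixed (binomialEdgeIdeal K G) ∧
    ∀ T : Set V, IsCutset G T → T.Nonempty → ∃ t ∈ T, IsCutset G (T \ {t})

/-- `S` is the vertex set of a block of `G`: the induced subgraph `G[S]` is connected and has no cut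
vertex, and `S` is maximal with this property. -/
def IsBlock {V : Type*} (G : SimpleGraph V) (S : Set V) : Prop :=
  Maximal (fun S' : Set V => (G.induce S').Connected ∧ ∀ v, ¬ IsCutVertex (G.induce S') v) S

/-- The graph obtained from `B` by attaching to each `w ∈ W` one whisker `{w, f_w}`, where
`f_w = Sum.inr w` is a new vertex. -/
def withWhiskers {V : Type*} (B : SimpleGraph V) (W : Set V) : SimpleGraph (V ⊕ ↥W) where
  Adj a b := match a, b with
    | Sum.inl u, Sum.inl v => B.Adj u v
    | Sum.inl u, Sum.inr w => u = w
    | Sum.inr w, Sum.inl u => u = w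
    | Sum.inr _, Sum.inr _ => False
  symm := ⟨by
    rintro (u | w) (v | w') h
    · exact SimpleGraph.Adj.symm h
    · exact h
    · exact h
    · exact h⟩
  loopless := ⟨by
    rintro (u | w) h
    · exact B.loopless.irrefl u h
    · exact h⟩

end BinomialEdge

/-!
The minimal primes of `J_H` are the ideals `P_T(H)` of the cutsets `T` of `H`, and `P_T(H)` has
height `|V(H)| + |T| - c_H(T)`. Hence `J_H` is unmixed if and only if `c_H(T) = |T| + c_H(∅)` for
all cutsets `T`. For `H` the graph `B` with whiskers at `W` and `w ∈ W`, this condition passes from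
`H` to `H ∖ {w}` because `T ∪ {w}` is a cutset of `H` for each cutset `T` of `H ∖ {w}`, unless `T`
contains all neighbours of `w` in `B`. Call such a `T` an obstruction at `w`.

Suppose that `|W| = 3` and that there are obstructions at all three vertices of `W`. Accessibility
gives every vertex of `B` a neighbour in `W`, so some `m ∈ W` is adjacent to the other two, `a` and
`b`. It also shrinks the obstruction at `a` to a cutset with a single vertex `y` outside `W`. Hence
either `b` has at most one neighbour besides `m`, or `{b, m, y}` cuts off a nonempty set disjoint
from `W`, a pocket. In a smallest pocket the obstructions at `b` and `m` restrict to two cutsets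
with incompatible numbers of components, so there are no pockets. Thus `a` and `b` have only one
further neighbour each, `p` and `q`, and the obstruction at `m` yields a vertex `y` such that all
neighbours of `p` and `q` lie in `{a, b, p, q, y}`. Now the obstruction at `a` requires that `q` and
`y` be separated, while the obstruction at `b` requires that they be adjacent.
-/

namespace BinomialEdge

section Separation

variable {V : Type*} {G : SimpleGraph V} {S T K F : Set V} {a b c t x y r : V}

/-- Outside `T`, the set `K` is a union of connected components of `G ∖ T`; its intersection with
`T` is irrelevant. -/
def IsClosedOff (G : SimpleGraph V) (T K : Set V) : Prop :=
  ∀ ⦃x y⦄, G.Adj x y → x ∉ T → y ∉ T → x ∈ K → y ∈ K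

lemma IsClosedOff.compl (hK : IsClosedOff G T K) : IsClosedOff G T Kᶜ :=
  fun _ _ hxy hx hy hxK hyK => hxK (hK hxy.symm hy hx hyK)

lemma IsClosedOff.mono (hK : IsClosedOff G S K) (hST : S ⊆ T) : IsClosedOff G T K :=
  fun _ _ hxy hx hy => hK hxy (fun h => hx (hST h)) fun h => hy (hST h)

/-- The vertices `a` and `b` lie outside `T` and in different components of `G ∖ T`. -/
def Separated (G : SimpleGraph V) (T : Set V) (a b : V) : Prop :=
  a ∉ T ∧ b ∉ T ∧ ∃ K, IsClosedOff G T K ∧ a ∈ K ∧ b ∉ K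

lemma Separated.symm (h : Separated G T a b) : Separated G T b a :=
  let ⟨ha, hb, K, hK, haK, hbK⟩ := h
  ⟨hb, ha, Kᶜ, hK.compl, hbK, not_not.2 haK⟩

lemma Separated.ne (h : Separated G T a b) : a ≠ b := by
  rintro rfl
  obtain ⟨-, -, K, -, haK, hbK⟩ := h
  exact hbK haK

lemma not_separated_self : ¬ Separated G T a a := fun h => h.ne rfl

lemma Separated.not_adj (h : Separated G T a b) : ¬ G.Adj a b :=
  let ⟨ha, hb, _, hK, haK, hbK⟩ := h
  fun hab => hbK (hK hab ha hb haK)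

lemma Separated.or_of_notMem (h : Separated G T a b) (hc : c ∉ T) :
    Separated G T a c ∨ Separated G T c b := by
  obtain ⟨ha, hb, K, hK, haK, hbK⟩ := h
  by_cases hcK : c ∈ K
  · exact Or.inr ⟨hc, hb, K, hK, hcK, hbK⟩
  · exact Or.inl ⟨ha, hc, K, hK, haK, hcK⟩

lemma Separated.mono (h : Separated G S a b) (hST : S ⊆ T) (ha : a ∉ T) (hb : b ∉ T) :
    Separated G T a b :=
  let ⟨_, _, K, hK, haK, hbK⟩ := h
  ⟨ha, hb, K, hK.mono hST, haK, hbK⟩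

lemma Separated.exists_notMem (h : Separated G T a b) (y : V) :
    ∃ K, IsClosedOff G T K ∧ y ∉ K ∧ (a ∈ K ∧ b ∉ K ∨ b ∈ K ∧ a ∉ K) := by
  obtain ⟨-, -, K, hK, haK, hbK⟩ := h
  by_cases hy : y ∈ K
  · exact ⟨Kᶜ, hK.compl, not_not.2 hy, Or.inr ⟨hbK, not_not.2 haK⟩⟩
  · exact ⟨K, hK, hy, Or.inl ⟨haK, hbK⟩⟩

lemma Separated.of_union (h : Separated G (F ∪ T) a b) (hF : IsClosedOff G T F) :
    Separated G T a b := by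
  obtain ⟨ha, hb, K, hK, haK, hbK⟩ := h
  refine ⟨fun h => ha (Or.inr h), fun h => hb (Or.inr h), K \ F, ?_,
    ⟨haK, fun h => ha (Or.inl h)⟩, fun h => hbK h.1⟩
  intro x y hxy hx hy hxK
  have hyF : y ∉ F := hF.compl hxy hx hy hxK.2
  exact ⟨hK hxy (by simp [hxK.2, hx]) (by simp [hyF, hy]) hxK.1, hyF⟩

lemma separated_iff_not_reachable {a b : ↥Tᶜ} :
    Separated G T a b ↔ ¬ (deleteSet G T).Reachable a b := by
  constructor
  · rintro ⟨-, -, K, hK, haK, hbK⟩ ⟨p⟩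
    refine hbK ?_
    induction p with
    | nil => exact haK
    | @cons x y _ hxy _ ih => exact ih (hK hxy x.2 y.2 haK) hbK
  · intro h
    refine ⟨a.2, b.2, {x | ∃ hx : x ∈ Tᶜ, (deleteSet G T).Reachable a ⟨x, hx⟩}, ?_,
      ⟨a.2, SimpleGraph.Reachable.refl _⟩, fun ⟨_, h'⟩ => h h'⟩
    rintro x y hxy - hy ⟨hx, hax⟩
    have hxy' : (deleteSet G T).Adj ⟨x, hx⟩ ⟨y, hy⟩ := hxy
    exact ⟨hy, hax.trans hxy'.reachable⟩

lemma connectedComponentMk_eq_iff {a b : ↥Tᶜ} :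
    (deleteSet G T).connectedComponentMk a = (deleteSet G T).connectedComponentMk b ↔
      ¬ Separated G T a b := by
  rw [SimpleGraph.ConnectedComponent.eq, separated_iff_not_reachable, not_not]

lemma Separated.sdiff_singleton (h : Separated G T x y) (ht : t ∈ T)
    (hnbr : ∀ b₁ b₂, G.Adj t b₁ → G.Adj t b₂ → ¬ Separated G T b₁ b₂) :
    Separated G (T \ {t}) x y := by
  obtain ⟨hx, hy, K, hK, hxK, hyK⟩ := h
  have hxt : x ≠ t := fun h => hx (h ▸ ht)
  have hyt : y ≠ t := fun h => hy (h ▸ ht)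
  refine ⟨fun h => hx h.1, fun h => hy h.1, ?_⟩
  -- All neighbours of `t` outside `T` lie on one side of `K`; `t` joins that side.
  by_cases hk : ∃ k ∈ K, k ∉ T ∧ G.Adj t k
  · obtain ⟨k, hkK, hkT, htk⟩ := hk
    have hside : ∀ v ∉ T, G.Adj t v → v ∈ K := fun v hv htv => by
      by_contra hvK
      exact hnbr k v htk htv ⟨hkT, hv, K, hK, hkK, hvK⟩
    refine ⟨insert t K, fun u v huv hu hv => ?_, Or.inr hxK, by simp [hyt, hyK]⟩
    grind [IsClosedOff]
  · refine ⟨K \ {t}, fun u v huv hu hv => ?_, ⟨hxK, hxt⟩, fun h => hyK h.1⟩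
    grind [IsClosedOff, SimpleGraph.adj_comm]

/-- The vertices cut off from `r` by the deletion of `T`. -/
def farSide (G : SimpleGraph V) (T : Set V) (r : V) : Set V := {x | Separated G T x r}

lemma isClosedOff_farSide : IsClosedOff G T (farSide G T r) :=
  fun _ _ hxy _ hy hx => (Separated.or_of_notMem hx hy).resolve_left fun h => h.not_adj hxy

lemma neighborSet_subset_farSide_union (hx : x ∈ farSide G T r) :
    G.neighborSet x ⊆ farSide G T r ∪ T := fun _ hxy =>
  or_iff_not_imp_right.2 fun hy => isClosedOff_farSide hxy hx.1 hy hx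

lemma Separated.farSide_nonempty (h : Separated G T a b) (hr : r ∉ T) :
    (farSide G T r).Nonempty :=
  (h.or_of_notMem hr).elim (fun h => ⟨a, h⟩) fun h => ⟨b, h.symm⟩

lemma not_separated_farSide_union (hr : r ∉ T) (a b : V) :
    ¬ Separated G (farSide G T r ∪ T) a b := fun h =>
  ((h.of_union isClosedOff_farSide).or_of_notMem hr).elim
    (fun h' => h.1 (Or.inl h')) fun h' => h.2.1 (Or.inl h'.symm)

end Separation

section Counting

variable {V : Type*} {G : SimpleGraph V} {T L : Set V} {a b c t v : V}

lemma ncard_le_numComponents [Finite V] (hT : ∀ x ∈ L, x ∉ T)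
    (hL : L.Pairwise (Separated G T)) : L.ncard ≤ numComponents G T := by
  rw [← Nat.card_coe_set_eq]
  refine Nat.card_le_card_of_injective
    (fun x : L => (deleteSet G T).connectedComponentMk ⟨x, hT x x.2⟩) fun x y hxy => ?_
  by_contra hne
  exact connectedComponentMk_eq_iff.1 hxy (hL x.2 y.2 fun h => hne (Subtype.ext h))

lemma numComponents_le_ncard [Finite V] (hT : ∀ x ∈ L, x ∉ T)
    (hL : ∀ y ∉ T, ∃ x ∈ L, ¬ Separated G T x y) : numComponents G T ≤ L.ncard := by
  rw [← Nat.card_coe_set_eq]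
  refine Nat.card_le_card_of_surjective
    (fun x : L => (deleteSet G T).connectedComponentMk ⟨x, hT x x.2⟩) fun c => ?_
  induction c using SimpleGraph.ConnectedComponent.ind with
  | _ y =>
    obtain ⟨x, hx, hxy⟩ := hL y y.2
    exact ⟨⟨x, hx⟩, connectedComponentMk_eq_iff.2 hxy⟩

lemma Separated.two_le_numComponents [Finite V] (h : Separated G T a b) :
    2 ≤ numComponents G T := by
  rw [← Set.ncard_pair h.ne]
  exact ncard_le_numComponents (by simp [h.1, h.2.1]) (by grind [Set.Pairwise, Separated.symm])

lemma three_le_numComponents [Finite V] (hab : Separated G T a b) (hac : Separated G T a c)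
    (hbc : Separated G T b c) : 3 ≤ numComponents G T := by
  rw [← Set.ncard_eq_three.2 ⟨a, b, c, hab.ne, hac.ne, hbc.ne, rfl⟩]
  exact ncard_le_numComponents (by simp [hab.1, hab.2.1, hac.2.1])
    (by grind [Set.Pairwise, Separated.symm])

/-- `L` contains exactly one vertex of each connected component of `G ∖ T`. -/
structure IsTransversal (G : SimpleGraph V) (T L : Set V) : Prop where
  notMem : ∀ x ∈ L, x ∉ T
  pairwise : L.Pairwise (Separated G T)
  exists_not_separated : ∀ y ∉ T, ∃ x ∈ L, ¬ Separated G T x y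

lemma IsTransversal.ncard_eq [Finite V] (h : IsTransversal G T L) :
    L.ncard = numComponents G T :=
  (ncard_le_numComponents h.notMem h.pairwise).antisymm
    (numComponents_le_ncard h.notMem h.exists_not_separated)

lemma exists_isTransversal (G : SimpleGraph V) (T : Set V) : ∃ L, IsTransversal G T L := by
  refine ⟨Set.range fun C : (deleteSet G T).ConnectedComponent => (C.out : V), ?_, ?_, ?_⟩
  · rintro _ ⟨C, rfl⟩
    exact C.out.2
  · rintro _ ⟨C, rfl⟩ _ ⟨D, rfl⟩ hne
    by_contra hs
    rw [← connectedComponentMk_eq_iff] at hs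
    exact hne (by rw [(Quot.out_eq C).symm.trans (hs.trans (Quot.out_eq D))])
  · intro y hy
    exact ⟨_, ⟨(deleteSet G T).connectedComponentMk ⟨y, hy⟩, rfl⟩,
      connectedComponentMk_eq_iff (b := ⟨y, hy⟩).1 (Quot.out_eq _)⟩

/-- Putting the vertex `t` back into `G ∖ T` merges components. -/
def componentMap (G : SimpleGraph V) (T : Set V) (t : V) :
    (deleteSet G T).ConnectedComponent → (deleteSet G (T \ {t})).ConnectedComponent :=
  SimpleGraph.ConnectedComponent.map (G.induceHomOfLE
    (Set.compl_subset_compl.2 (Set.sdiff_subset (s := T) (t := {t})))).toHom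

lemma componentMap_mk (x : ↥Tᶜ) :
    componentMap G T t ((deleteSet G T).connectedComponentMk x) =
      (deleteSet G (T \ {t})).connectedComponentMk ⟨x, fun h => x.2 h.1⟩ := rfl

lemma componentMap_injective (ht : t ∈ T)
    (h : ∀ b₁ b₂, G.Adj t b₁ → G.Adj t b₂ → ¬ Separated G T b₁ b₂) :
    Function.Injective (componentMap G T t) := by
  intro C D
  induction C using SimpleGraph.ConnectedComponent.ind
  induction D using SimpleGraph.ConnectedComponent.ind
  rw [componentMap_mk, componentMap_mk, connectedComponentMk_eq_iff, connectedComponentMk_eq_iff]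
  exact mt fun hs => hs.sdiff_singleton ht h

lemma componentMap_surjective (hb : b ∉ T) (htb : G.Adj t b) :
    Function.Surjective (componentMap G T t) := by
  intro D
  induction D using SimpleGraph.ConnectedComponent.ind with
  | _ y =>
    by_cases hy : (y : V) ∈ T
    · have hyt : (y : V) = t := by_contra fun h => y.2 ⟨hy, h⟩
      refine ⟨(deleteSet G T).connectedComponentMk ⟨b, hb⟩, ?_⟩
      rw [componentMap_mk, connectedComponentMk_eq_iff]
      exact fun h => h.not_adj (by simpa only [hyt] using htb.symm)
    · exact ⟨(deleteSet G T).connectedComponentMk ⟨y, hy⟩, rfl⟩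

lemma componentMap_not_injective (h₁ : G.Adj t a) (h₂ : G.Adj t b) (hs : Separated G T a b) :
    ¬ Function.Injective (componentMap G T t) := by
  intro hinj
  refine connectedComponentMk_eq_iff (a := ⟨a, hs.1⟩) (b := ⟨b, hs.2.1⟩).1 (hinj ?_) hs
  rw [componentMap_mk, componentMap_mk, connectedComponentMk_eq_iff]
  intro h
  rcases h.or_of_notMem (c := t) fun ht => ht.2 rfl with h | h
  · exact h.not_adj h₁.symm
  · exact h.not_adj h₂

lemma numComponents_sdiff_lt_iff [Finite V] (ht : t ∈ T) :
    numComponents G (T \ {t}) < numComponents G T ↔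
      ∃ b₁ b₂, G.Adj t b₁ ∧ G.Adj t b₂ ∧ Separated G T b₁ b₂ := by
  constructor
  · contrapose!
    exact fun h => Nat.card_le_card_of_injective _ (componentMap_injective ht h)
  · rintro ⟨b₁, b₂, h₁, h₂, hs⟩
    have := Fintype.ofFinite (deleteSet G T).ConnectedComponent
    have := Fintype.ofFinite (deleteSet G (T \ {t})).ConnectedComponent
    rw [numComponents, numComponents, Nat.card_eq_fintype_card, Nat.card_eq_fintype_card]
    exact Fintype.card_lt_of_surjective_not_injective _ (componentMap_surjective hs.1 h₁)
      (componentMap_not_injective h₁ h₂ hs)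

lemma isCutset_iff [Finite V] : IsCutset G T ↔
    ∀ t ∈ T, ∃ b₁ b₂, G.Adj t b₁ ∧ G.Adj t b₂ ∧ Separated G T b₁ b₂ :=
  forall₂_congr fun _ ht => numComponents_sdiff_lt_iff ht

lemma numComponents_empty : numComponents G ∅ = Nat.card G.ConnectedComponent :=
  Nat.card_congr (SimpleGraph.Iso.connectedComponentEquiv
    ⟨(Equiv.setCongr Set.compl_empty).trans (Equiv.Set.univ V), Iff.rfl⟩)

lemma isCutVertex_iff_numComponents_lt :
    IsCutVertex G v ↔ numComponents G ({v} \ {v}) < numComponents G {v} := by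
  rw [sdiff_self, Set.bot_eq_empty, numComponents_empty]
  rfl

lemma isCutVertex_iff [Finite V] :
    IsCutVertex G v ↔ ∃ b₁ b₂, G.Adj v b₁ ∧ G.Adj v b₂ ∧ Separated G {v} b₁ b₂ := by
  rw [isCutVertex_iff_numComponents_lt, numComponents_sdiff_lt_iff (Set.mem_singleton v)]

lemma numComponents_empty_of_connected (h : G.Connected) : numComponents G ∅ = 1 := by
  rw [numComponents_empty, Nat.card_eq_one_iff_unique]
  have := h.nonempty
  exact ⟨h.preconnected.subsingleton_connectedComponent, inferInstance⟩

end Counting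

section AccessibleBlock

variable {V : Type*} {B : SimpleGraph V} {W T Tu Tw Z D F : Set V} {a b b₁ b₂ t u v w y r : V}

/-- For `t ∈ T`: putting `t` back into the graph obtained from `B` by attaching whiskers at `W` and
deleting `T` merges components. The whisker at `t ∈ W` is isolated after the deletion, so for such
`t` any neighbour outside `T` will do. -/
def IsWhiskerCutAt (B : SimpleGraph V) (W T : Set V) (t : V) : Prop :=
  (t ∈ W → ∃ b ∉ T, B.Adj t b) ∧
    (t ∉ W → ∃ b₁ b₂, B.Adj t b₁ ∧ B.Adj t b₂ ∧ Separated B T b₁ b₂)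

lemma isWhiskerCutAt_of_separated (h₁ : B.Adj t b₁) (h₂ : B.Adj t b₂)
    (hs : Separated B T b₁ b₂) : IsWhiskerCutAt B W T t :=
  ⟨fun _ => ⟨b₁, hs.1, h₁⟩, fun _ => ⟨b₁, b₂, h₁, h₂, hs⟩⟩

lemma isWhiskerCutAt_of_mem (ht : t ∈ W) (hb : b ∉ T) (htb : B.Adj t b) :
    IsWhiskerCutAt B W T t :=
  ⟨fun _ => ⟨b, hb, htb⟩, fun h => (h ht).elim⟩

/-- `T` is a cutset of the graph obtained from `B` by attaching whiskers at `W`. -/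
def IsWhiskerCutset (B : SimpleGraph V) (W T : Set V) : Prop :=
  ∀ t ∈ T, IsWhiskerCutAt B W T t

/-- `T` contains all neighbours of `v` in `B`, and it is a cutset of the graph obtained from `B` by
attaching whiskers at `W` and deleting `v`. Such a set witnesses that a cutset of that graph need
not extend to one containing `v`. -/
structure IsObstruction (B : SimpleGraph V) (W : Set V) (v : V) (T : Set V) : Prop where
  notMem : v ∉ T
  neighborSet_subset : B.neighborSet v ⊆ T
  isWhiskerCutAt : ∀ t ∈ T, IsWhiskerCutAt B W (insert v T) t

lemma IsObstruction.isClosedOff_singleton (h : IsObstruction B W v T) :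
    IsClosedOff B T {v} := by
  rintro _ y hxy - hy rfl
  exact absurd (h.neighborSet_subset hxy) hy

lemma IsObstruction.isWhiskerCutset (h : IsObstruction B W v T) : IsWhiskerCutset B W T := by
  intro t ht
  refine ⟨fun htW => ?_, fun htW => ?_⟩
  · obtain ⟨b, hb, htb⟩ := (h.isWhiskerCutAt t ht).1 htW
    exact ⟨b, fun hbT => hb (Or.inr hbT), htb⟩
  · obtain ⟨b₁, b₂, h₁, h₂, hs⟩ := (h.isWhiskerCutAt t ht).2 htW
    exact ⟨b₁, b₂, h₁, h₂, hs.of_union h.isClosedOff_singleton⟩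

/-- `B` is connected without cut vertices, and attaching whiskers at `W` gives an accessible
graph. Each `w ∈ T ∩ W` leaves its whisker as a further isolated vertex of the complement of `T`, so
unmixedness prescribes `|T ∖ W| + 1` components for `B ∖ T`. -/
structure IsAccessibleBlock (B : SimpleGraph V) (W : Set V) : Prop where
  not_separated_empty : ∀ a b, ¬ Separated B ∅ a b
  not_separated_singleton : ∀ v a b, ¬ Separated B {v} a b
  numComponents_eq : ∀ T, IsWhiskerCutset B W T → numComponents B T = (T \ W).ncard + 1
  exists_isWhiskerCutset_sdiff : ∀ T, IsWhiskerCutset B W T → T.Nonempty →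
    ∃ t ∈ T, IsWhiskerCutset B W (T \ {t})

/-- Besides possibly `w`, the vertex `u` has at most one neighbour, and it lies outside `W`. -/
def IsPendantAt (B : SimpleGraph V) (W : Set V) (u w : V) : Prop :=
  ∃ y ∉ W, B.neighborSet u ⊆ {w, y}

/-- `F` is a nonempty union of components of `B ∖ {u, w, y}` avoiding `W`, where `u` and `w` are
adjacent vertices of `W`, and the rest of `B ∖ {u, w, y}` is connected. -/
structure IsPocket (B : SimpleGraph V) (W : Set V) (u w y : V) (F : Set V) : Prop where
  left_mem : u ∈ W
  right_mem : w ∈ W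
  adj : B.Adj u w
  apex_notMem : y ∉ W
  nonempty : F.Nonempty
  disjoint : Disjoint F W
  apex_notMem_pocket : y ∉ F
  neighborSet_subset : ∀ f ∈ F, B.neighborSet f ⊆ F ∪ {u, w, y}
  rest_connected : ∀ a b, ¬ Separated B (F ∪ {u, w, y}) a b

namespace IsAccessibleBlock

lemma inter_nonempty [Finite V] (h : IsAccessibleBlock B W) (hT : IsWhiskerCutset B W T)
    (hne : T.Nonempty) : (T ∩ W).Nonempty := by
  obtain ⟨Z, hZT, ⟨hZ, hZne⟩, hmin⟩ := exists_minimal_le_of_wellFoundedLT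
    (fun Z : Set V => IsWhiskerCutset B W Z ∧ Z.Nonempty) T ⟨hT, hne⟩
  obtain ⟨t, ht, hcut⟩ := h.exists_isWhiskerCutset_sdiff Z hZ hZne
  have hZt : Z = {t} := by
    by_contra hne'
    have hmem : (Z \ {t}).Nonempty :=
      Set.sdiff_nonempty.2 fun hs => hne' (hs.antisymm (Set.singleton_subset_iff.2 ht))
    exact (hmin ⟨hcut, hmem⟩ Set.sdiff_subset ht).2 rfl
  subst hZt
  refine ⟨t, hZT rfl, by_contra fun htW => ?_⟩
  obtain ⟨b₁, b₂, -, -, hs⟩ := (hZ t rfl).2 htW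
  exact h.not_separated_singleton _ _ _ hs

lemma exists_subset_sdiff_eq_singleton [Finite V] (h : IsAccessibleBlock B W)
    (hD : IsWhiskerCutset B W D) (hne : (D \ W).Nonempty) :
    ∃ Z ⊆ D, IsWhiskerCutset B W Z ∧ ∃ y, Z \ W = {y} := by
  obtain ⟨Z, hZD, ⟨hZ, hZne⟩, hmin⟩ := exists_minimal_le_of_wellFoundedLT
    (fun Z : Set V => IsWhiskerCutset B W Z ∧ (Z \ W).Nonempty) D ⟨hD, hne⟩
  obtain ⟨t, ht, hcut⟩ := h.exists_isWhiskerCutset_sdiff Z hZ (hZne.mono Set.sdiff_subset)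
  refine ⟨Z, hZD, hZ, t, (Set.Nonempty.subset_singleton_iff hZne).1 fun x hx => ?_⟩
  by_contra hxt
  exact (hmin ⟨hcut, x, ⟨hx.1, hxt⟩, hx.2⟩ Set.sdiff_subset ht).2 rfl

lemma exists_adj_mem_of_not_adj [Finite V] (h : IsAccessibleBlock B W) (hab : a ≠ b)
    (hnadj : ¬ B.Adj a b) : ∃ w ∈ W, B.Adj a w := by
  -- The neighbours of `a` with a neighbour in `K` separate `a` from `K`.
  set K : Set V := {k | k ≠ a ∧ ¬ B.Adj a k}
  set N : Set V := {z | B.Adj a z ∧ ∃ k ∈ K, B.Adj z k}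
  have hK : IsClosedOff B N K := by
    rintro x y hxy - hy hxK
    refine ⟨?_, fun hay => hy ⟨hay, x, hxK, hxy.symm⟩⟩
    rintro rfl
    exact hxK.2 hxy.symm
  have haN : a ∉ N := fun ha => ha.1.ne rfl
  have haK : a ∉ K := fun ha => ha.1 rfl
  have hN : IsWhiskerCutset B W N := by
    rintro z ⟨haz, k, hk, hzk⟩
    exact isWhiskerCutAt_of_separated hzk haz.symm ⟨fun hkN => hk.2 hkN.1, haN, K, hK, hk, haK⟩
  have hNne : N.Nonempty := by
    by_contra hN
    rw [Set.not_nonempty_iff_eq_empty] at hN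
    exact h.not_separated_empty b a ⟨id, id, K, hN ▸ hK, ⟨hab.symm, hnadj⟩, haK⟩
  obtain ⟨w, hw, hwW⟩ := h.inter_nonempty hN hNne
  exact ⟨w, hwW, hw.1⟩

lemma exists_adj_mem [Finite V] (h : IsAccessibleBlock B W) (hW : W.Nontrivial) (a : V) :
    ∃ w ∈ W, B.Adj a w := by
  obtain ⟨w, hw, hwa⟩ := hW.exists_ne a
  by_cases haw : B.Adj a w
  · exact ⟨w, hw, haw⟩
  · exact h.exists_adj_mem_of_not_adj hwa.symm haw

lemma not_isObstruction_of_neighborSet_subset [Finite V] (h : IsAccessibleBlock B W)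
    (hW : W.Nontrivial) (hF : F.Nonempty) (hFW : Disjoint F W) (hy : y ∉ W)
    (hnbr : ∀ f ∈ F, B.neighborSet f ⊆ F ∪ {u, y}) : ¬ IsObstruction B W u T := by
  intro hT
  rw [Set.disjoint_left] at hFW
  have hFT : F ⊆ T := by
    intro f hf
    obtain ⟨w, hw, hfw⟩ := h.exists_adj_mem hW f
    have hwu : w = u := by grind [hnbr f hf hfw]
    exact hT.neighborSet_subset (hwu ▸ hfw.symm)
  obtain ⟨f, hf⟩ := hF
  obtain ⟨b₁, b₂, h₁, h₂, hs⟩ := (hT.isWhiskerCutAt f (hFT hf)).2 (hFW hf)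
  have hnbr_eq : ∀ b ∉ insert u T, B.Adj f b → b = y := fun b hb hfb => by
    grind [hnbr f hf hfb]
  exact hs.ne ((hnbr_eq b₁ hs.1 h₁).trans (hnbr_eq b₂ hs.2.1 h₂).symm)

lemma exists_adj_of_neighborSet_subset [Finite V] (h : IsAccessibleBlock B W)
    (hW : W.Nontrivial) (hF : F.Nonempty) (hFW : Disjoint F W) (hy : y ∉ W)
    (hnbr : ∀ f ∈ F, B.neighborSet f ⊆ F ∪ {u, w, y}) (hT : IsObstruction B W w T) :
    ∃ f ∈ F, B.Adj u f := by
  by_contra! hne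
  refine h.not_isObstruction_of_neighborSet_subset hW hF hFW hy (fun f hf x hfx => ?_) hT
  have hxu : x ≠ u := fun hxu => hne f hf (hxu ▸ hfx.symm)
  exact (hnbr f hf hfx).imp_right fun hx => hx.resolve_left hxu

lemma right_mem_of_farSide_inter_subset [Finite V] (h : IsAccessibleBlock B W)
    (hW : W.Nontrivial) (hy : y ∉ W) (hZ : IsWhiskerCutset B W Z) (hZsub : Z ⊆ {u, w, y})
    (hS : (farSide B Z r).Nonempty) (hSW : farSide B Z r ∩ W ⊆ {u})
    (hu : IsObstruction B W u T) : w ∈ Z := by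
  by_contra hw
  have huS : u ∉ farSide B Z r := by
    obtain ⟨f, hf⟩ := hS
    intro huS
    have hZne : Z.Nonempty := by
      by_contra hZne
      rw [Set.not_nonempty_iff_eq_empty] at hZne
      exact h.not_separated_empty _ _ (hZne ▸ hf)
    obtain ⟨x, hxZ, hxW⟩ := h.inter_nonempty hZ hZne
    grind [huS.1, hZsub hxZ]
  refine h.not_isObstruction_of_neighborSet_subset hW hS ?_ hy (fun f hf x hfx => ?_) hu
  · exact Set.disjoint_left.2 fun x hxS hxW => huS (hSW ⟨hxS, hxW⟩ ▸ hxS)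
  · grind [neighborSet_subset_farSide_union hf hfx]

lemma left_mem_of_farSide_inter_subset [Finite V] (h : IsAccessibleBlock B W)
    (hW : W.Nontrivial) (hy : y ∉ W) (hZsub : Z ⊆ {u, w, y}) (hS : (farSide B Z r).Nonempty)
    (hSW : farSide B Z r ∩ W ⊆ {u}) (hw : IsObstruction B W w T) : u ∈ farSide B Z r ∪ Z := by
  by_contra hu
  refine h.not_isObstruction_of_neighborSet_subset hW hS ?_ hy (fun f hf x hfx => ?_) hw
  · exact Set.disjoint_left.2 fun x hxS hxW => hu (Or.inl (hSW ⟨hxS, hxW⟩ ▸ hxS))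
  · grind [neighborSet_subset_farSide_union hf hfx]

lemma pendant_or_pocket [Finite V] (h : IsAccessibleBlock B W) (hW : W.Nontrivial) (hu : u ∈ W)
    (hw : w ∈ W) (huw : B.Adj u w) (hTu : IsObstruction B W u Tu) (hTw : IsObstruction B W w Tw)
    (hZ : IsWhiskerCutset B W Z) (hZy : Z \ W = {y}) (hZsub : Z ⊆ {u, w, y}) (hwr : B.Adj w r)
    (hr : r ∉ Z) (hother : ∀ x ∈ W, x ≠ u → x ≠ w → ¬ Separated B Z x r) :
    IsPendantAt B W u w ∨ ∃ F ⊆ farSide B Z r, IsPocket B W u w y F := by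
  obtain ⟨hyZ, hy⟩ : y ∈ Z \ W := hZy.symm ▸ rfl
  obtain ⟨b₁, b₂, -, -, hs⟩ := (hZ y hyZ).2 hy
  have hS : (farSide B Z r).Nonempty := hs.farSide_nonempty hr
  have hwS : w ∉ farSide B Z r := fun hwS => hwS.not_adj hwr
  have hSW : farSide B Z r ∩ W ⊆ {u} := by
    rintro x ⟨hxS, hxW⟩
    by_contra hxu
    exact hother x hxW hxu (fun hxw => hwS (hxw ▸ hxS)) hxS
  have hwZ : w ∈ Z := h.right_mem_of_farSide_inter_subset hW hy hZ hZsub hS hSW hTu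
  have huSZ : u ∈ farSide B Z r ∪ Z := h.left_mem_of_farSide_inter_subset hW hy hZsub hS hSW hTw
  have hcover : farSide B Z r \ {u} ∪ {u, w, y} = farSide B Z r ∪ Z := by
    ext x
    have := @hZsub x
    grind
  by_cases hF : (farSide B Z r \ {u}).Nonempty
  · refine Or.inr ⟨_, Set.sdiff_subset, hu, hw, huw, hy, hF, ?_, ?_, ?_, ?_⟩
    · exact Set.disjoint_left.2 fun x hx hxW => hx.2 (hSW ⟨hx.1, hxW⟩)
    · exact fun hyF => hyF.1.1 hyZ
    · exact fun f hf => hcover ▸ neighborSet_subset_farSide_union hf.1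
    · exact hcover ▸ not_separated_farSide_union hr
  · have hSu : farSide B Z r = {u} :=
      (Set.Nonempty.subset_singleton_iff hS).1 (Set.sdiff_eq_empty.1
        (Set.not_nonempty_iff_eq_empty.1 hF))
    refine Or.inl ⟨y, hy, fun x hux => ?_⟩
    have hxu : x ≠ u := hux.ne'
    grind [neighborSet_subset_farSide_union (G := B) (hSu ▸ rfl : u ∈ farSide B Z r) hux]

end IsAccessibleBlock

end AccessibleBlock

section Pocket

variable {V : Type*} {B : SimpleGraph V} {W T T' Tu Tw D F : Set V} {d f p q r t u w x y : V}

namespace IsPocket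

lemma symm (hF : IsPocket B W u w y F) : IsPocket B W w u y F := by
  have hswap : ({w, u, y} : Set V) = {u, w, y} := Set.insert_comm _ _ _
  exact ⟨hF.right_mem, hF.left_mem, hF.adj.symm, hF.apex_notMem, hF.nonempty, hF.disjoint,
    hF.apex_notMem_pocket, hswap ▸ hF.neighborSet_subset, hswap ▸ hF.rest_connected⟩

lemma notMem_of_mem (hF : IsPocket B W u w y F) (hx : x ∈ W) : x ∉ F :=
  fun hxF => Set.disjoint_left.1 hF.disjoint hxF hx

lemma apex_ne_of_mem (hF : IsPocket B W u w y F) (hx : x ∈ W) : y ≠ x :=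
  fun hyx => hF.apex_notMem (hyx ▸ hx)

lemma mem_or_of_adj (hF : IsPocket B W u w y F) (hf : f ∈ F) (hfx : B.Adj f x) :
    x ∈ F ∨ x = u ∨ x = w ∨ x = y :=
  hF.neighborSet_subset f hf hfx

lemma adj_or_adj [Finite V] (hF : IsPocket B W u w y F) (h : IsAccessibleBlock B W)
    (hf : f ∈ F) : B.Adj u f ∨ B.Adj w f := by
  obtain ⟨x, hx, hfx⟩ := h.exists_adj_mem ⟨u, hF.left_mem, w, hF.right_mem, hF.adj.ne⟩ f
  grind [hF.mem_or_of_adj hf hfx, hF.notMem_of_mem hx, hF.apex_ne_of_mem hx, B.adj_comm]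

lemma exists_adj_apex [Finite V] (hF : IsPocket B W u w y F) (h : IsAccessibleBlock B W)
    (hr : r ∉ F ∪ {u, w, y}) (hwr : B.Adj w r) (hu : ¬ IsPendantAt B W u w) :
    ∃ r' ∉ F ∪ {u, w, y}, B.Adj y r' := by
  -- Otherwise `{u, w}` is a cutset separating `F ∪ {y}` from `r`.
  by_contra! hy
  obtain ⟨x, hux, hx⟩ := Set.not_subset.1 fun hsub => hu ⟨y, hF.apex_notMem, hsub⟩
  have hyu := hF.apex_ne_of_mem hF.left_mem
  have hyw := hF.apex_ne_of_mem hF.right_mem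
  have hcut : IsWhiskerCutset B W {u, w} := by
    rintro t (rfl | rfl)
    · exact isWhiskerCutAt_of_mem hF.left_mem (by grind [hux.ne']) hux
    · exact isWhiskerCutAt_of_mem hF.right_mem (by grind) hwr
  have hclosed : IsClosedOff B {u, w} (insert y F) := by
    rintro a b hab - hb (rfl | ha)
    · by_contra hbF
      exact hy b (by grind [hab.ne']) hab
    · grind [hF.mem_or_of_adj ha hab]
  have hsep : Separated B {u, w} y r :=
    ⟨by simp [hyu, hyw], by grind, insert y F, hclosed, Or.inl rfl, by grind⟩
  have hW : ({u, w} : Set V) \ W = ∅ :=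
    Set.sdiff_eq_empty.2 (Set.pair_subset hF.left_mem hF.right_mem)
  have hcount := h.numComponents_eq _ hcut
  rw [hW, Set.ncard_empty] at hcount
  exact absurd hsep.two_le_numComponents (by omega)

lemma exists_ssubset [Finite V] (hF : IsPocket B W u w y F) (h : IsAccessibleBlock B W)
    (hTu : IsObstruction B W u Tu) (hTw : IsObstruction B W w Tw) (hr : r ∉ F ∪ {u, w, y})
    (hwr : B.Adj w r) (hu : ¬ IsPendantAt B W u w) (hD : IsWhiskerCutset B W D)
    (hDF : D ⊆ F ∪ {u, w}) (hDW : (D \ W).Nonempty) :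
    ∃ y' F', F' ⊂ F ∧ y' ∈ F ∧ IsPocket B W u w y' F' := by
  obtain ⟨r', hr', hyr'⟩ := hF.exists_adj_apex h hr hwr hu
  obtain ⟨Z, hZD, hZ, y', hZy'⟩ := h.exists_subset_sdiff_eq_singleton hD hDW
  obtain ⟨hy'Z, hy'W⟩ : y' ∈ Z \ W := hZy'.symm ▸ rfl
  have huW := hF.left_mem
  have hwW := hF.right_mem
  have hy'F : y' ∈ F := by grind [hDF (hZD hy'Z)]
  have hZF : Z ⊆ F ∪ {u, w, y} := fun x hx => by grind [hDF (hZD hx)]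
  have hZsub : Z ⊆ {u, w, y'} := by
    intro x hx
    by_cases hxW : x ∈ W
    · grind [hDF (hZD hx), hF.notMem_of_mem hxW]
    · have hxy' : x ∈ ({y'} : Set V) := hZy' ▸ ⟨hx, hxW⟩
      grind
  have hrest : ∀ x ∉ F ∪ {u, w, y}, ¬ Separated B Z x r := fun x hx hs =>
    hF.rest_connected _ _ (hs.mono hZF hx hr)
  have hother : ∀ x ∈ W, x ≠ u → x ≠ w → ¬ Separated B Z x r := fun x hx hxu hxw =>
    hrest x (by grind [hF.notMem_of_mem hx, hF.apex_ne_of_mem hx])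
  have hyr : ¬ Separated B Z y r := fun hs =>
    (hs.or_of_notMem fun hr'Z => hr' (hZF hr'Z)).elim (fun hs => hs.not_adj hyr') (hrest r' hr')
  obtain ⟨F', hF'r, hF'⟩ := (h.pendant_or_pocket ⟨u, huW, w, hwW, hF.adj.ne⟩ huW hwW hF.adj hTu hTw
    hZ hZy' hZsub hwr (fun hrZ => hr (hZF hrZ)) hother).resolve_left hu
  refine ⟨y', F', ⟨fun x hx => by_contra fun hxF => ?_, fun hsub => ?_⟩, hy'F, hF'⟩
  · have hxW : x ∉ W := fun hxW => hF'.notMem_of_mem hxW hx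
    have hxy : x ≠ y := fun hxy => hyr (hxy ▸ hF'r hx)
    exact hrest x (by grind) (hF'r hx)
  · exact hF'.apex_notMem_pocket (hsub hy'F)

end IsPocket

/-- The cutset obtained by restricting an obstruction `T` at `p` to a pocket `F` hanging on `p`,
`q` and `y`, and adding those of the attaching vertices which still merge components. -/
def pocketCutset (B : SimpleGraph V) (p q y : V) (F T : Set V) : Set V :=
  {x | x ∈ F ∩ T ∨ x = q ∨ (x = y ∧ y ∈ T ∧ ∃ d ∈ F \ T, B.Adj y d) ∨
    (x = p ∧ ∃ r ∉ F ∪ {p, q, y}, B.Adj p r)}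

lemma pocketCutset_subset : pocketCutset B p q y F T ⊆ F ∪ {p, q, y} := by
  rintro x (hx | rfl | ⟨rfl, -⟩ | ⟨rfl, -⟩) <;> simp_all

namespace IsPocket

lemma notMem_pocketCutset (hF : IsPocket B W p q y F) (hd : d ∈ F \ T) :
    d ∉ pocketCutset B p q y F T := by
  have hp := hF.notMem_of_mem hF.left_mem
  have hq := hF.notMem_of_mem hF.right_mem
  have hy := hF.apex_notMem_pocket
  rintro (hx | rfl | ⟨rfl, -⟩ | ⟨rfl, -⟩) <;> grind

lemma apex_mem_pocketCutset_iff (hF : IsPocket B W p q y F) :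
    y ∈ pocketCutset B p q y F T ↔ y ∈ T ∧ ∃ d ∈ F \ T, B.Adj y d := by
  have hp := hF.apex_ne_of_mem hF.left_mem
  have hq := hF.apex_ne_of_mem hF.right_mem
  have hy := hF.apex_notMem_pocket
  simp [pocketCutset, hp, hq, hy]

lemma left_mem_pocketCutset_iff (hF : IsPocket B W p q y F) :
    p ∈ pocketCutset B p q y F T ↔ ∃ r ∉ F ∪ {p, q, y}, B.Adj p r := by
  have hp := hF.notMem_of_mem hF.left_mem
  have hy := (hF.apex_ne_of_mem hF.left_mem).symm
  simp [pocketCutset, hp, hy, hF.adj.ne]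

lemma exists_separated_of_mem (hF : IsPocket B W p q y F) (hT : IsObstruction B W p T)
    (htF : t ∈ F) (htT : t ∈ T) :
    ∃ d ∈ F \ T, ∃ b, B.Adj t d ∧ B.Adj t b ∧ Separated B (pocketCutset B p q y F T) d b := by
  obtain ⟨b₁, b₂, h₁, h₂, hs⟩ :=
    (hT.isWhiskerCutAt t htT).2 fun htW => hF.notMem_of_mem htW htF
  have hqT : q ∈ T := hT.neighborSet_subset hF.adj
  have hp := hF.notMem_of_mem hF.left_mem
  have hnbr : ∀ b ∉ insert p T, B.Adj t b → b ∈ F \ T ∨ b = y := fun b hb htb => by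
    grind [hF.mem_or_of_adj htF htb]
  obtain ⟨K, hK, hyK, hside⟩ := hs.exists_notMem y
  have hKF : IsClosedOff B (pocketCutset B p q y F T) (K ∩ F) := by
    rintro x v hxv hx hv ⟨hxK, hxF⟩
    have hxT : x ∉ T := fun hxT => hx (Or.inl ⟨hxF, hxT⟩)
    have hpx : ¬ B.Adj p x := fun hpx => hxT (hT.neighborSet_subset hpx)
    have hvT : v ∈ insert p T ∨ v ∈ K := by
      by_contra! hv'
      exact hv'.2 (hK hxv (by grind) hv'.1 hxK)
    have hvF := hF.mem_or_of_adj hxF hxv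
    simp only [pocketCutset, Set.mem_ofPred_eq] at hv
    grind [B.adj_comm]
  have hmem : ∀ b ∉ insert p T, B.Adj t b → b ∉ pocketCutset B p q y F T := by
    intro b hb htb
    rcases hnbr b hb htb with hbF | rfl
    · exact hF.notMem_pocketCutset hbF
    · rw [hF.apex_mem_pocketCutset_iff]
      exact fun hbT => hb (Or.inr hbT.1)
  have hm₁ := hmem b₁ hs.1 h₁
  have hm₂ := hmem b₂ hs.2.1 h₂
  rcases hside with ⟨hb₁, hb₂⟩ | ⟨hb₂, hb₁⟩
  · have hd : b₁ ∈ F \ T := (hnbr b₁ hs.1 h₁).resolve_right fun hby => hyK (hby ▸ hb₁)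
    exact ⟨b₁, hd, b₂, h₁, h₂, hm₁, hm₂, K ∩ F, hKF, ⟨hb₁, hd.1⟩, fun hb => hb₂ hb.1⟩
  · have hd : b₂ ∈ F \ T := (hnbr b₂ hs.2.1 h₂).resolve_right fun hby => hyK (hby ▸ hb₂)
    exact ⟨b₂, hd, b₁, h₂, h₁, hm₂, hm₁, K ∩ F, hKF, ⟨hb₂, hd.1⟩, fun hb => hb₁ hb.1⟩

lemma inter_nonempty [Finite V] (hF : IsPocket B W p q y F) (h : IsAccessibleBlock B W)
    (hT : B.neighborSet p ⊆ T) (hT' : IsObstruction B W q T') : (F ∩ T).Nonempty := by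
  obtain ⟨f, hf, hpf⟩ := h.exists_adj_of_neighborSet_subset
    ⟨p, hF.left_mem, q, hF.right_mem, hF.adj.ne⟩ hF.nonempty hF.disjoint hF.apex_notMem
    hF.neighborSet_subset hT'
  exact ⟨f, hf, hT hpf⟩

lemma isWhiskerCutset_pocketCutset [Finite V] (hF : IsPocket B W p q y F)
    (h : IsAccessibleBlock B W) (hT : IsObstruction B W p T) (hT' : IsObstruction B W q T')
    (hr : r ∉ F ∪ {p, q, y}) (hyr : B.Adj y r) :
    IsWhiskerCutset B W (pocketCutset B p q y F T) := by
  obtain ⟨t₀, ht₀F, ht₀T⟩ := hF.inter_nonempty h hT.neighborSet_subset hT'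
  obtain ⟨d₀, hd₀, -⟩ := hF.exists_separated_of_mem hT ht₀F ht₀T
  have hqd₀ : B.Adj q d₀ :=
    (hF.adj_or_adj h hd₀.1).resolve_left fun hpd => hd₀.2 (hT.neighborSet_subset hpd)
  rintro t (ht | rfl | ⟨rfl, hyT, d, hd, hyd⟩ | ⟨rfl, n, hn, hpn⟩)
  · obtain ⟨d, -, b, htd, htb, hs⟩ := hF.exists_separated_of_mem hT ht.1 ht.2
    exact isWhiskerCutAt_of_separated htd htb hs
  · exact isWhiskerCutAt_of_mem hF.right_mem (hF.notMem_pocketCutset hd₀) hqd₀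
  · refine isWhiskerCutAt_of_separated hyd hyr ⟨hF.notMem_pocketCutset hd,
      fun hrX => hr (pocketCutset_subset hrX), F, fun x v hxv hx hv hxF => ?_, hd.1,
      fun hrF => hr (Or.inl hrF)⟩
    have hpx : ¬ B.Adj p x := fun hpx => hx (Or.inl ⟨hxF, hT.neighborSet_subset hpx⟩)
    have htX := hF.apex_mem_pocketCutset_iff.2 ⟨hyT, d, hd, hyd⟩
    have hqX : q ∈ pocketCutset B p q t F T := Or.inr (Or.inl rfl)
    grind [hF.mem_or_of_adj hxF hxv, B.adj_comm]
  · exact isWhiskerCutAt_of_mem hF.left_mem (fun hnX => hn (pocketCutset_subset hnX)) hpn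

lemma pocketCutset_sdiff (hF : IsPocket B W p q y F) (hy : y ∈ pocketCutset B p q y F T) :
    pocketCutset B p q y F T \ W = insert y (F ∩ T) := by
  ext x
  constructor
  · rintro ⟨hx | rfl | ⟨rfl, -⟩ | ⟨rfl, -⟩, hxW⟩
    · exact Or.inr hx
    · exact absurd hF.right_mem hxW
    · exact Or.inl rfl
    · exact absurd hF.left_mem hxW
  · rintro (rfl | hx)
    · exact ⟨hy, hF.apex_notMem⟩
    · exact ⟨Or.inl hx, fun hxW => hF.notMem_of_mem hxW hx.1⟩

lemma numComponents_pocketCutset_le [Finite V] (hF : IsPocket B W p q y F)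
    (hy : y ∈ pocketCutset B p q y F T) (hr : r ∉ F ∪ {p, q, y}) :
    numComponents B (pocketCutset B p q y F T) ≤
      (F \ T).ncard + 1 + ({p} \ pocketCutset B p q y F T).ncard := by
  set X := pocketCutset B p q y F T
  have hXF : X ⊆ F ∪ {p, q, y} := pocketCutset_subset
  have hqX : q ∈ X := Or.inr (Or.inl rfl)
  have hcard : (insert r (F \ T) ∪ {p} \ X).ncard ≤ (F \ T).ncard + 1 + ({p} \ X).ncard :=
    (Set.ncard_union_le _ _).trans (Nat.add_le_add_right (Set.ncard_insert_le _ _) _)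
  refine le_trans (numComponents_le_ncard ?_ fun x hx => ?_) hcard
  · rintro x ((rfl | hx) | hx)
    · exact fun hxX => hr (hXF hxX)
    · exact hF.notMem_pocketCutset hx
    · exact hx.2
  · by_cases hxF : x ∈ F
    · have hxT : x ∉ T := fun hxT => hx (Or.inl ⟨hxF, hxT⟩)
      exact ⟨x, Or.inl (Or.inr ⟨hxF, hxT⟩), not_separated_self⟩
    by_cases hxp : x = p
    · exact ⟨x, Or.inr ⟨hxp, hx⟩, not_separated_self⟩
    · exact ⟨r, Or.inl (Or.inl rfl), fun hs =>
        hF.rest_connected _ _ (hs.mono hXF hr (by grind))⟩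

lemma ncard_inter_add_one_le [Finite V] (hF : IsPocket B W p q y F) (h : IsAccessibleBlock B W)
    (hT : IsObstruction B W p T) (hT' : IsObstruction B W q T') (hr : r ∉ F ∪ {p, q, y})
    (hyr : B.Adj y r) (hmin : ∀ D ⊆ F ∪ {p, q}, IsWhiskerCutset B W D → D ⊆ W) :
    (F ∩ T).ncard + 1 ≤ (F \ T).ncard + ({p} \ pocketCutset B p q y F T).ncard := by
  have hcut := hF.isWhiskerCutset_pocketCutset h hT hT' hr hyr
  have hy : y ∈ pocketCutset B p q y F T := by
    by_contra hy
    obtain ⟨t, htF, htT⟩ := hF.inter_nonempty h hT.neighborSet_subset hT'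
    refine hF.notMem_of_mem (hmin _ (fun x hx => ?_) hcut (Or.inl ⟨htF, htT⟩)) htF
    grind [pocketCutset_subset hx]
  have hcount := h.numComponents_eq _ hcut
  rw [hF.pocketCutset_sdiff hy, Set.ncard_insert_of_notMem fun hyF =>
    hF.apex_notMem_pocket hyF.1] at hcount
  have := hF.numComponents_pocketCutset_le hy hr
  omega

lemma ncard_sdiff_le [Finite V] (hF : IsPocket B W u w y F) (h : IsAccessibleBlock B W)
    (hTu : B.neighborSet u ⊆ Tu) (hTw : B.neighborSet w ⊆ Tw) :
    (F \ Tw).ncard ≤ (F ∩ Tu).ncard :=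
  Set.ncard_le_ncard fun _ hf =>
    ⟨hf.1, hTu ((hF.adj_or_adj h hf.1).resolve_right fun hwf => hf.2 (hTw hwf))⟩

lemma isPendantAt [Finite V] (hF : IsPocket B W u w y F) (h : IsAccessibleBlock B W)
    (hTu : IsObstruction B W u Tu) (hTw : IsObstruction B W w Tw) (hr : r ∉ F ∪ {u, w, y})
    (hwr : B.Adj w r) : IsPendantAt B W u w := by
  by_contra hu
  induction hn : F.ncard using Nat.strong_induction_on generalizing F y with
  | _ n ih =>
    have hmin : ∀ D ⊆ F ∪ {u, w}, IsWhiskerCutset B W D → D ⊆ W := by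
      intro D hDF hD
      by_contra hDW
      obtain ⟨y', F', hF'F, hy', hF'⟩ := hF.exists_ssubset h hTu hTw hr hwr hu hD hDF
        (Set.sdiff_nonempty.2 hDW)
      exact ih _ (hn ▸ Set.ncard_lt_ncard hF'F) hF' (by grind [hF'F.subset]) rfl
    obtain ⟨r', hr', hyr'⟩ := hF.exists_adj_apex h hr hwr hu
    have hswap : ({w, u, y} : Set V) = {u, w, y} := Set.insert_comm _ _ _
    have hle_u := hF.ncard_inter_add_one_le h hTu hTw hr' hyr' hmin
    have hle_w := hF.symm.ncard_inter_add_one_le h hTw hTu (hswap ▸ hr') hyr'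
      (Set.pair_comm u w ▸ hmin)
    have hw : {w} \ pocketCutset B w u y F Tw = ∅ := by
      rw [Set.sdiff_eq_empty, Set.singleton_subset_iff, hF.symm.left_mem_pocketCutset_iff]
      exact ⟨r, hswap ▸ hr, hwr⟩
    have hu_le : ({u} \ pocketCutset B u w y F Tu).ncard ≤ 1 :=
      (Set.ncard_le_ncard Set.sdiff_subset).trans (Set.ncard_singleton u).le
    have h₁ := hF.ncard_sdiff_le h hTu.neighborSet_subset hTw.neighborSet_subset
    have h₂ := hF.symm.ncard_sdiff_le h hTw.neighborSet_subset hTu.neighborSet_subset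
    rw [hw, Set.ncard_empty] at hle_w
    omega

end IsPocket

end Pocket

section ThreeWhiskers

variable {V : Type*} {B : SimpleGraph V} {W T Ta Tb Tm : Set V} {a b m p q v y : V}

lemma IsObstruction.adj_and_separated (hT : IsObstruction B W a T) (hap : B.Adj a p)
    (hp : p ∉ W) (hnbr : B.neighborSet p ⊆ {a, q, y}) :
    B.Adj p q ∧ B.Adj p y ∧ Separated B (insert a T) q y := by
  obtain ⟨b₁, b₂, h₁, h₂, hs⟩ := (hT.isWhiskerCutAt p (hT.neighborSet_subset hap)).2 hp
  have hb₁ : b₁ = q ∨ b₁ = y := (hnbr h₁).resolve_left fun h => hs.1 (Or.inl h)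
  have hb₂ : b₂ = q ∨ b₂ = y := (hnbr h₂).resolve_left fun h => hs.2.1 (Or.inl h)
  rcases hb₁ with rfl | rfl <;> rcases hb₂ with rfl | rfl
  · exact absurd hs not_separated_self
  · exact ⟨h₁, h₂, hs⟩
  · exact ⟨h₂, h₁, hs.symm⟩
  · exact absurd hs not_separated_self

namespace IsAccessibleBlock

lemma sdiff_nonempty_of_isObstruction [Finite V] (h : IsAccessibleBlock B W)
    (hW : W.Nontrivial) (hT : IsObstruction B W v T) : (T \ W).Nonempty := by
  by_contra hne
  have hcount := h.numComponents_eq T hT.isWhiskerCutset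
  rw [Set.not_nonempty_iff_eq_empty.1 hne, Set.ncard_empty] at hcount
  obtain ⟨w, hw, hvw⟩ := h.exists_adj_mem hW v
  obtain ⟨b, hb, -⟩ := (hT.isWhiskerCutAt w (hT.neighborSet_subset hvw)).1 hw
  have hsep : Separated B T v b :=
    ⟨hT.notMem, fun hbT => hb (Or.inr hbT), {v}, hT.isClosedOff_singleton, rfl,
      fun hbv => hb (Or.inl hbv)⟩
  exact absurd hsep.two_le_numComponents (by omega)

lemma isPendantAt_of_isObstruction [Finite V] (h : IsAccessibleBlock B W) (hW : W = {a, b, m})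
    (hab : a ≠ b) (hma : B.Adj m a) (hmb : B.Adj m b) (hTa : IsObstruction B W a Ta)
    (hTb : IsObstruction B W b Tb) (hTm : IsObstruction B W m Tm) : IsPendantAt B W b m := by
  have haW : a ∈ W := by simp [hW]
  have hbW : b ∈ W := by simp [hW]
  have hmW : m ∈ W := by simp [hW]
  have hW₂ : W.Nontrivial := ⟨a, haW, b, hbW, hab⟩
  obtain ⟨Z, hZTa, hZ, y, hZy⟩ := h.exists_subset_sdiff_eq_singleton hTa.isWhiskerCutset
    (h.sdiff_nonempty_of_isObstruction hW₂ hTa)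
  have haZ : a ∉ Z := fun haZ => hTa.notMem (hZTa haZ)
  have hZsub : Z ⊆ {b, m, y} := by
    intro x hx
    by_cases hxW : x ∈ W
    · grind
    · exact Or.inr (Or.inr (hZy ▸ ⟨hx, hxW⟩ : x ∈ ({y} : Set V)))
  have hother : ∀ x ∈ W, x ≠ b → x ≠ m → ¬ Separated B Z x a := fun x hx hxb hxm => by
    have hxa : x = a := by grind
    exact hxa ▸ not_separated_self
  obtain hpend | ⟨F, -, hF⟩ := h.pendant_or_pocket hW₂ hbW hmW hmb.symm hTb hTm hZ hZy hZsub hma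
    haZ hother
  · exact hpend
  · have haF : a ∉ F ∪ {b, m, y} := by
      grind [hF.notMem_of_mem haW, hF.apex_ne_of_mem haW, hma.ne]
    exact hF.isPendantAt h hTb hTm haF hma

lemma exists_neighborSet_subset_of_isObstruction [Finite V] (h : IsAccessibleBlock B W)
    (hW : W = {a, b, m}) (hab : a ≠ b) (hma : B.Adj m a) (hmb : B.Adj m b)
    (hTm : IsObstruction B W m Tm) :
    ∃ y ∉ W, ∃ F : Set V, F.Nonempty ∧ Disjoint F W ∧ y ∉ F ∧
      ∀ f ∈ F, B.neighborSet f ⊆ F ∪ {a, b, y} := by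
  have hW₂ : W.Nontrivial := ⟨a, by simp [hW], b, by simp [hW], hab⟩
  obtain ⟨Z, hZTm, hZ, y, hZy⟩ := h.exists_subset_sdiff_eq_singleton hTm.isWhiskerCutset
    (h.sdiff_nonempty_of_isObstruction hW₂ hTm)
  obtain ⟨hyZ, hy⟩ : y ∈ Z \ W := hZy.symm ▸ rfl
  have hmZ : m ∉ Z := fun hmZ => hTm.notMem (hZTm hmZ)
  have hZsub : Z ⊆ {a, b, y} := by
    intro x hx
    by_cases hxW : x ∈ W
    · grind
    · exact Or.inr (Or.inr (hZy ▸ ⟨hx, hxW⟩ : x ∈ ({y} : Set V)))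
  obtain ⟨b₁, b₂, -, -, hs⟩ := (hZ y hyZ).2 hy
  refine ⟨y, hy, farSide B Z m, hs.farSide_nonempty hmZ, Set.disjoint_left.2 ?_,
    fun hyF => hyF.1 hyZ, fun f hf x hfx => ?_⟩
  · intro x hxF hxW
    rw [hW] at hxW
    rcases hxW with rfl | rfl | rfl
    · exact hxF.not_adj hma.symm
    · exact hxF.not_adj hmb.symm
    · exact not_separated_self hxF
  · exact (neighborSet_subset_farSide_union hf hfx).imp_right fun hx => hZsub hx

lemma exists_neighborSet_eq_of_isObstruction [Finite V] (h : IsAccessibleBlock B W)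
    (hW : W = {a, b, m}) (hab : a ≠ b) (hma : B.Adj m a) (hmb : B.Adj m b)
    (hTa : IsObstruction B W a Ta) (hTb : IsObstruction B W b Tb) (hTm : IsObstruction B W m Tm) :
    ∃ p q y : V, p ∉ W ∧ q ∉ W ∧ y ∉ W ∧ y ≠ p ∧
      B.neighborSet a = {m, p} ∧ B.neighborSet b = {m, q} ∧
      B.neighborSet p ⊆ {a, b, q, y} ∧ B.neighborSet q ⊆ {a, b, p, y} := by
  have hW₂ : W.Nontrivial := ⟨a, by simp [hW], b, by simp [hW], hab⟩
  have hW' : W = {b, a, m} := hW.trans (Set.insert_comm _ _ _)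
  obtain ⟨p, hp, hap⟩ := h.isPendantAt_of_isObstruction hW' hab.symm hmb hma hTb hTa hTm
  obtain ⟨q, hq, hbq⟩ := h.isPendantAt_of_isObstruction hW hab hma hmb hTa hTb hTm
  obtain ⟨y, hy, F, hF, hFW, hyF, hnbr⟩ :=
    h.exists_neighborSet_subset_of_isObstruction hW hab hma hmb hTm
  have hFW' := Set.disjoint_left.1 hFW
  have : m ∉ F := fun hmF => hFW' hmF (by simp [hW])
  obtain ⟨hpF, hadj_ap⟩ : p ∈ F ∧ B.Adj a p := by
    obtain ⟨f, hf, haf⟩ := h.exists_adj_of_neighborSet_subset hW₂ hF hFW hy hnbr hTb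
    grind [hap haf]
  obtain ⟨hqF, hadj_bq⟩ : q ∈ F ∧ B.Adj b q := by
    obtain ⟨f, hf, hbf⟩ := h.exists_adj_of_neighborSet_subset hW₂ hF hFW hy
      (Set.insert_comm a b {y} ▸ hnbr) hTa
    grind [hbq hbf]
  have hFpq : F ⊆ {p, q} := by
    intro f hf
    obtain ⟨w, hw, hfw⟩ := h.exists_adj_mem hW₂ f
    have hw' := hnbr f hf hfw
    have haf := @hap f
    have hbf := @hbq f
    simp only [SimpleGraph.mem_neighborSet] at haf hbf
    grind [hfw.symm]
  refine ⟨p, q, y, hp, hq, hy, by grind, hap.antisymm ?_, hbq.antisymm ?_, fun x hpx => ?_,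
    fun x hqx => ?_⟩
  · exact Set.pair_subset hma.symm hadj_ap
  · exact Set.pair_subset hmb.symm hadj_bq
  · grind [hnbr p hpF hpx, hpx.ne']
  · grind [hnbr q hqF hqx, hqx.ne']

lemma neighborSet_ne_of_mem [Finite V] (h : IsAccessibleBlock B W) (ha : a ∈ W) (hb : b ∈ W)
    (hm : m ∈ W) (hab : a ≠ b) (hp : p ∉ W) (hy : y ∉ W) (hyp : y ≠ p)
    (hap : B.neighborSet a = {m, p}) : B.neighborSet b ≠ {m, p} := by
  -- Otherwise `{m, p}` is a cutset separating `a`, `b` and `y` from each other.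
  intro hbp
  have hadj : ∀ x ∈ ({m, p} : Set V), B.Adj a x ∧ B.Adj b x := fun x hx =>
    ⟨hap.superset hx, hbp.superset hx⟩
  obtain ⟨ham, hbm⟩ := hadj m (by simp)
  obtain ⟨hap', hbp'⟩ := hadj p (by simp)
  have hsep : ∀ c, B.neighborSet c = {m, p} → B.Adj c m → B.Adj c p → ∀ x ∉ ({m, p} : Set V),
      x ≠ c → Separated B {m, p} c x := by
    rintro c hc hcm hcp x hx hxc
    refine ⟨by simp [hcm.ne, hcp.ne], hx, {c}, ?_, rfl, hxc⟩
    rintro _ v hcv - hv rfl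
    exact absurd (hc ▸ hcv : v ∈ ({m, p} : Set V)) hv
  have hymp : y ∉ ({m, p} : Set V) := by grind
  have hsab := hsep a hap ham hap' b (by simp [hbm.ne, hbp'.ne]) hab.symm
  have hthree := three_le_numComponents hsab (hsep a hap ham hap' y hymp (by grind))
    (hsep b hbp hbm hbp' y hymp (by grind))
  have hcut : IsWhiskerCutset B W {m, p} := by
    rintro t (rfl | rfl)
    · exact isWhiskerCutAt_of_mem hm hsab.1 ham.symm
    · exact isWhiskerCutAt_of_separated hap'.symm hbp'.symm hsab
  have hW : ({m, p} : Set V) \ W = {p} := by grind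
  have hcount := h.numComponents_eq _ hcut
  rw [hW, Set.ncard_singleton] at hcount
  omega

lemma not_isObstruction_of_adj [Finite V] (h : IsAccessibleBlock B W) (hW : W = {a, b, m})
    (hab : a ≠ b) (hma : B.Adj m a) (hmb : B.Adj m b) (hTa : IsObstruction B W a Ta)
    (hTb : IsObstruction B W b Tb) : ¬ IsObstruction B W m Tm := by
  intro hTm
  obtain ⟨p, q, y, hp, hq, hy, hyp, hNa, hNb, hNp, hNq⟩ :=
    h.exists_neighborSet_eq_of_isObstruction hW hab hma hmb hTa hTb hTm
  have hpq : p ≠ q := by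
    rintro rfl
    exact h.neighborSet_ne_of_mem (by simp [hW]) (by simp [hW]) (by simp [hW]) hab hp hy hyp hNa hNb
  have hadj_a : ∀ x, B.Adj a x ↔ x = m ∨ x = p := fun x => Set.ext_iff.1 hNa x
  have hadj_b : ∀ x, B.Adj b x ↔ x = m ∨ x = q := fun x => Set.ext_iff.1 hNb x
  have hNp' : B.neighborSet p ⊆ {a, q, y} := fun x hpx => by
    grind [hNp hpx, hpx.symm]
  have hNq' : B.neighborSet q ⊆ {b, p, y} := fun x hqx => by
    grind [hNq hqx, hqx.symm]
  obtain ⟨-, -, hsep⟩ := hTa.adj_and_separated ((hadj_a p).2 (Or.inr rfl)) hp hNp'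
  obtain ⟨-, hqy, -⟩ := hTb.adj_and_separated ((hadj_b q).2 (Or.inr rfl)) hq hNq'
  exact hsep.not_adj hqy

theorem exists_forall_not_isObstruction [Finite V] (h : IsAccessibleBlock B W)
    (hW : W.ncard = 3) : ∃ w ∈ W, ∀ T, ¬ IsObstruction B W w T := by
  by_contra! hobs
  obtain ⟨a, b, c, hab, hac, hbc, hWeq⟩ := Set.ncard_eq_three.1 hW
  obtain ⟨Ta, hTa⟩ := hobs a (by simp [hWeq])
  obtain ⟨Tb, hTb⟩ := hobs b (by simp [hWeq])
  obtain ⟨Tc, hTc⟩ := hobs c (by simp [hWeq])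
  have hadj : ∀ x, B.Adj x a ∨ B.Adj x b ∨ B.Adj x c := by
    intro x
    obtain ⟨w, hw, hxw⟩ := h.exists_adj_mem ⟨a, by simp [hWeq], b, by simp [hWeq], hab⟩ x
    grind
  have hA : ¬ (B.Adj a b ∧ B.Adj a c) := fun hadj =>
    h.not_isObstruction_of_adj (by grind) hbc hadj.1 hadj.2 hTb hTc hTa
  have hB : ¬ (B.Adj b a ∧ B.Adj b c) := fun hadj =>
    h.not_isObstruction_of_adj (by grind) hac hadj.1 hadj.2 hTa hTc hTb
  have hC : ¬ (B.Adj c a ∧ B.Adj c b) := fun hadj =>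
    h.not_isObstruction_of_adj hWeq hab hadj.1 hadj.2 hTa hTb hTc
  -- Every vertex of the triple has a neighbour in it, so one of them has two.
  grind [hadj a, hadj b, hadj c, B.adj_comm, B.irrefl]

end IsAccessibleBlock

end ThreeWhiskers

section LabelIdeal

open MvPolynomial

variable {V ι L K : Type*} [Field K] [Field L] {ℓ : V → ι} {S T : Set V} {i j k v : V}

/-- The generator `x_i y_j - x_j y_i` of a binomial edge ideal. -/
noncomputable def edgeBinomial (K : Type*) [Field K] (i j : V) : MvPolynomial (V ⊕ V) K :=
  X (Sum.inl i) * X (Sum.inr j) - X (Sum.inl j) * X (Sum.inr i)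

lemma edgeBinomial_self : edgeBinomial K i i = 0 := sub_self _

lemma neg_edgeBinomial : -edgeBinomial K i j = edgeBinomial K j i := neg_sub _ _

open Classical in
/-- The substitution `x_v ↦ a_v s_{ℓ v}`, `y_v ↦ a_v t_{ℓ v}` for `v ∉ T`, sending both variables of
`v ∈ T` to zero. Here `a`, `s`, `t` are the variables indexed by the three summands. -/
noncomputable def labelHom (K : Type*) [Field K] (ℓ : V → ι) (T : Set V) :
    MvPolynomial (V ⊕ V) K →ₐ[K] MvPolynomial (V ⊕ ι ⊕ ι) K :=
  aeval (Sum.elim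
    (fun v => if v ∈ T then 0 else X (Sum.inl v) * X (Sum.inr (Sum.inl (ℓ v))))
    (fun v => if v ∈ T then 0 else X (Sum.inl v) * X (Sum.inr (Sum.inr (ℓ v)))))

/-- The smallest prime ideal containing both variables of each `v ∈ T` and the binomials of all
pairs of vertices outside `T` with the same label; see `labelIdeal_le`. -/
noncomputable def labelIdeal (K : Type*) [Field K] (ℓ : V → ι) (T : Set V) :
    Ideal (MvPolynomial (V ⊕ V) K) :=
  RingHom.ker (labelHom K ℓ T)

instance labelIdeal_isPrime : (labelIdeal K ℓ T).IsPrime := RingHom.ker_isPrime _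

lemma X_inl_mem_labelIdeal : X (Sum.inl v) ∈ labelIdeal K ℓ T ↔ v ∈ T := by
  simp [labelIdeal, RingHom.mem_ker, labelHom, X_ne_zero]

lemma X_inr_mem_labelIdeal : X (Sum.inr v) ∈ labelIdeal K ℓ T ↔ v ∈ T := by
  simp [labelIdeal, RingHom.mem_ker, labelHom, X_ne_zero]

lemma edgeBinomial_mem_labelIdeal :
    edgeBinomial K i j ∈ labelIdeal K ℓ T ↔ i ∈ T ∨ j ∈ T ∨ ℓ i = ℓ j := by
  by_cases hi : i ∈ T
  · simp [labelIdeal, RingHom.mem_ker, labelHom, edgeBinomial, hi]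
  by_cases hj : j ∈ T
  · simp [labelIdeal, RingHom.mem_ker, labelHom, edgeBinomial, hj]
  simp only [labelIdeal, RingHom.mem_ker, labelHom, edgeBinomial, map_sub, map_mul, aeval_X,
    Sum.elim_inl, Sum.elim_inr, hi, hj, if_false, false_or]
  refine ⟨fun h => ?_, fun h => by rw [h]; ring⟩
  classical
  by_contra hne
  -- Evaluate at `a = 1`, `s` the indicator of `ℓ i` and `t` the indicator of `ℓ j`.
  have heval := congrArg (aeval (S₁ := K) (Sum.elim 1
    (Sum.elim (Pi.single (ℓ i) 1) (Pi.single (ℓ j) 1)))) h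
  simp [Ne.symm hne] at heval

lemma exists_eq_mul_of_forall_mul_eq_mul {f g : V → L}
    (h : ∀ i ∈ S, ∀ j ∈ S, f i * g j = f j * g i) :
    ∃ s t : L, ∀ i ∈ S, ∃ a, f i = a * s ∧ g i = a * t := by
  by_cases hex : ∃ i ∈ S, f i ≠ 0 ∨ g i ≠ 0
  · obtain ⟨i, hi, hfi | hgi⟩ := hex
    · refine ⟨f i, g i, fun j hj => ⟨f j / f i, by field_simp, ?_⟩⟩
      field_simp
      linear_combination h i hi j hj
    · refine ⟨f i, g i, fun j hj => ⟨g j / g i, ?_, by field_simp⟩⟩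
      field_simp
      linear_combination -(h i hi j hj)
  · push Not at hex
    exact ⟨0, 0, fun i hi => ⟨0, by simp [hex i hi]⟩⟩

lemma labelIdeal_le_ker [Algebra K L] (ψ : MvPolynomial (V ⊕ V) K →ₐ[K] L)
    (hT : ∀ v ∈ T, ψ (X (Sum.inl v)) = 0 ∧ ψ (X (Sum.inr v)) = 0)
    (hℓ : ∀ i ∉ T, ∀ j ∉ T, ℓ i = ℓ j → ψ (edgeBinomial K i j) = 0) :
    labelIdeal K ℓ T ≤ RingHom.ker ψ := by
  have hclass : ∀ c, ∃ s t : L, ∀ i ∈ {v | v ∉ T ∧ ℓ v = c}, ∃ a,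
      ψ (X (Sum.inl i)) = a * s ∧ ψ (X (Sum.inr i)) = a * t := by
    intro c
    refine exists_eq_mul_of_forall_mul_eq_mul fun i hi j hj => ?_
    have hij := hℓ i hi.1 j hj.1 (hi.2.trans hj.2.symm)
    simpa only [edgeBinomial, map_sub, map_mul, sub_eq_zero] using hij
  choose s t hst using hclass
  have hvertex : ∀ v, ∃ a : L, v ∉ T →
      ψ (X (Sum.inl v)) = a * s (ℓ v) ∧ ψ (X (Sum.inr v)) = a * t (ℓ v) := fun v => by
    by_cases hv : v ∈ T
    · exact ⟨0, fun hv' => absurd hv hv'⟩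
    · exact (hst (ℓ v) v ⟨hv, rfl⟩).imp fun a ha _ => ha
  choose a ha using hvertex
  have hfactor : ψ = (aeval (Sum.elim a (Sum.elim s t))).comp (labelHom K ℓ T) := by
    refine algHom_ext fun v => ?_
    rcases v with v | v <;> by_cases hv : v ∈ T
    · simp [labelHom, hv, hT v hv]
    · simp [labelHom, hv, (ha v hv).1]
    · simp [labelHom, hv, hT v hv]
    · simp [labelHom, hv, (ha v hv).2]
  intro f hf
  rw [RingHom.mem_ker, hfactor, AlgHom.comp_apply, RingHom.mem_ker.1 hf, map_zero]

lemma labelIdeal_le {Q : Ideal (MvPolynomial (V ⊕ V) K)} [Q.IsPrime]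
    (hT : ∀ v ∈ T, X (Sum.inl v) ∈ Q ∧ X (Sum.inr v) ∈ Q)
    (hℓ : ∀ i ∉ T, ∀ j ∉ T, ℓ i = ℓ j → edgeBinomial K i j ∈ Q) : labelIdeal K ℓ T ≤ Q := by
  let ψ : MvPolynomial (V ⊕ V) K →ₐ[K] FractionRing (MvPolynomial (V ⊕ V) K ⧸ Q) :=
    (IsScalarTower.toAlgHom K _ _).comp (Ideal.Quotient.mkₐ K Q)
  have hker : ∀ f, ψ f = 0 ↔ f ∈ Q := fun f => by
    change algebraMap _ (FractionRing (MvPolynomial (V ⊕ V) K ⧸ Q)) (Ideal.Quotient.mk Q f) = 0 ↔ _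
    rw [FaithfulSMul.algebraMap_eq_zero_iff, Ideal.Quotient.eq_zero_iff_mem]
  exact (labelIdeal_le_ker ψ (fun v hv => ⟨(hker _).2 (hT v hv).1, (hker _).2 (hT v hv).2⟩)
    fun i hi j hj hij => (hker _).2 (hℓ i hi j hj hij)).trans fun f hf => (hker f).1 hf

lemma labelIdeal_le_labelIdeal_iff {ι' : Type*} {ℓ' : V → ι'} :
    labelIdeal K ℓ S ≤ labelIdeal K ℓ' T ↔
      S ⊆ T ∧ ∀ i ∉ T, ∀ j ∉ T, ℓ i = ℓ j → ℓ' i = ℓ' j := by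
  constructor
  · refine fun h => ⟨fun v hv => X_inl_mem_labelIdeal.1 (h (X_inl_mem_labelIdeal.2 hv)),
      fun i hi j hj hij => ?_⟩
    have hmem := h (edgeBinomial_mem_labelIdeal.2 (Or.inr (Or.inr hij)))
    exact ((edgeBinomial_mem_labelIdeal.1 hmem).resolve_left hi).resolve_left hj
  · rintro ⟨hST, h⟩
    refine labelIdeal_le (fun v hv => ⟨X_inl_mem_labelIdeal.2 (hST hv),
      X_inr_mem_labelIdeal.2 (hST hv)⟩) fun i _ j _ hij => edgeBinomial_mem_labelIdeal.2 ?_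
    by_contra! hT
    exact hT.2.2 (h i hT.1 j hT.2.1 hij)

lemma edgeBinomial_mem_trans {Q : Ideal (MvPolynomial (V ⊕ V) K)} [hQ : Q.IsPrime]
    (hk : ¬ (X (Sum.inl k) ∈ Q ∧ X (Sum.inr k) ∈ Q)) (hik : edgeBinomial K i k ∈ Q)
    (hkj : edgeBinomial K k j ∈ Q) : edgeBinomial K i j ∈ Q := by
  have hx : X (Sum.inl k) * edgeBinomial K i j
      = X (Sum.inl i) * edgeBinomial K k j + X (Sum.inl j) * edgeBinomial K i k := by
    simp only [edgeBinomial]; ring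
  have hy : X (Sum.inr k) * edgeBinomial K i j
      = X (Sum.inr j) * edgeBinomial K i k + X (Sum.inr i) * edgeBinomial K k j := by
    simp only [edgeBinomial]; ring
  have hxQ : X (Sum.inl k) * edgeBinomial K i j ∈ Q :=
    hx ▸ Q.add_mem (Q.mul_mem_left _ hkj) (Q.mul_mem_left _ hik)
  have hyQ : X (Sum.inr k) * edgeBinomial K i j ∈ Q :=
    hy ▸ Q.add_mem (Q.mul_mem_left _ hik) (Q.mul_mem_left _ hkj)
  by_contra hij
  exact hk ⟨(hQ.mem_or_mem hxQ).resolve_right hij, (hQ.mem_or_mem hyQ).resolve_right hij⟩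

end LabelIdeal

section Height

open MvPolynomial

variable {V ι K : Type*} [Field K] {T : Set V} {v : V}

open Classical in
/-- The substitution `x_v ↦ 0`. -/
noncomputable def killX (K : Type*) [Field K] (v : V) :
    MvPolynomial (V ⊕ V) K →ₐ[K] MvPolynomial (V ⊕ V) K :=
  aeval (Sum.elim (fun u => if u = v then 0 else X (Sum.inl u)) fun u => X (Sum.inr u))

lemma killX_X_inl_self : killX K v (X (Sum.inl v)) = 0 := by simp [killX]

lemma killX_X_inl_of_ne {u : V} (h : u ≠ v) : killX K v (X (Sum.inl u)) = X (Sum.inl u) := by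
  simp [killX, h]

lemma killX_X_inr (u : V) : killX K v (X (Sum.inr u)) = X (Sum.inr u) := by simp [killX]

lemma labelIdeal_le_comap_killX {ℓ : V → ι} (hv : ∀ u ∉ T, ℓ u = ℓ v → u = v) :
    labelIdeal K ℓ T ≤ (labelIdeal K ℓ T).comap (killX K v) := by
  refine labelIdeal_le (fun u hu => ⟨Ideal.mem_comap.2 ?_, Ideal.mem_comap.2 ?_⟩)
    fun i hi j hj hij => Ideal.mem_comap.2 ?_
  · by_cases huv : u = v
    · rw [huv, killX_X_inl_self]
      exact zero_mem _
    · rw [killX_X_inl_of_ne huv]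
      exact X_inl_mem_labelIdeal.2 hu
  · rw [killX_X_inr]
    exact X_inr_mem_labelIdeal.2 hu
  · by_cases hij' : i = j
    · rw [hij', edgeBinomial_self, map_zero]
      exact zero_mem _
    have hiv : i ≠ v := fun hiv => hij' (hiv.trans (hv j hj (hiv ▸ hij.symm)).symm)
    have hjv : j ≠ v := fun hjv => hij' ((hv i hi (hjv ▸ hij)).trans hjv.symm)
    have hkill : killX K v (edgeBinomial K i j) = edgeBinomial K i j := by
      simp only [edgeBinomial, map_sub, map_mul, killX_X_inr, killX_X_inl_of_ne hiv,
        killX_X_inl_of_ne hjv]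
    rw [hkill]
    exact edgeBinomial_mem_labelIdeal.2 (Or.inr (Or.inr hij))

lemma comap_killX_labelIdeal {ℓ : V → ι} (hv : v ∈ T) :
    (labelIdeal K ℓ T).comap (killX K v) = labelIdeal K ℓ T := by
  have hcomp : (labelHom K ℓ T).comp (killX K v) = labelHom K ℓ T := by
    refine algHom_ext fun u => ?_
    rcases u with u | u
    · by_cases huv : u = v
      · simp [killX, labelHom, huv, hv]
      · simp [killX, labelHom, huv]
    · simp [killX, labelHom]
  conv_rhs => rw [labelIdeal, ← hcomp]
  rfl

/-- An isolated vertex `v` contributes the chain `P < κ⁻¹ P < P'` for `κ` the substitution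
`x_v ↦ 0`. -/
lemma height_labelIdeal_add_two_le {ℓ : V → ι} (hvT : v ∉ T) (hv : ∀ u ∉ T, ℓ u = ℓ v → u = v) :
    (labelIdeal K ℓ T).height + 2 ≤ (labelIdeal K ℓ (insert v T)).height := by
  have hlt : labelIdeal K ℓ T < (labelIdeal K ℓ T).comap (killX K v) := by
    refine (labelIdeal_le_comap_killX hv).lt_of_not_ge fun hle => hvT ?_
    refine X_inl_mem_labelIdeal.1 (hle (Ideal.mem_comap.2 ?_))
    rw [killX_X_inl_self]
    exact zero_mem _
  have hle : labelIdeal K ℓ T ≤ labelIdeal K ℓ (insert v T) :=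
    labelIdeal_le_labelIdeal_iff.2 ⟨Set.subset_insert v T, fun _ _ _ _ => id⟩
  have hlt' : (labelIdeal K ℓ T).comap (killX K v) < labelIdeal K ℓ (insert v T) := by
    rw [← comap_killX_labelIdeal (Set.mem_insert v T)]
    refine (Ideal.comap_mono hle).lt_of_not_ge fun hge => hvT ?_
    have hmem : X (Sum.inr v) ∈ (labelIdeal K ℓ (insert v T)).comap (killX K v) := by
      rw [Ideal.mem_comap, killX_X_inr]
      exact X_inr_mem_labelIdeal.2 (Set.mem_insert v T)
    have hmem' := Ideal.mem_comap.1 (hge hmem)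
    rwa [killX_X_inr, X_inr_mem_labelIdeal] at hmem'
  calc (labelIdeal K ℓ T).height + 2 = (labelIdeal K ℓ T).height + 1 + 1 := by
        rw [add_assoc, one_add_one_eq_two]
    _ ≤ ((labelIdeal K ℓ T).comap (killX K v)).height + 1 := by
        gcongr
        exact Ideal.height_add_one_le_of_lt_of_isPrime hlt
    _ ≤ (labelIdeal K ℓ (insert v T)).height :=
        Ideal.height_add_one_le_of_lt_of_isPrime hlt'

/-- A labelling whose labels outside `T` are themselves vertices outside `T`, each carrying its own
label. Such a vertex is the root of its class. -/
def IsRooted (ℓ : V → V) (T : Set V) : Prop :=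
  ∀ v ∉ T, ℓ v ∉ T ∧ ℓ (ℓ v) = ℓ v

variable {ℓ : V → V}

lemma two_mul_ncard_le_height_labelIdeal_id [Finite V] (T : Set V) :
    ((2 * T.ncard : ℕ) : ℕ∞) ≤ (labelIdeal K id T).height := by
  induction T, Set.toFinite T using Set.Finite.induction_on with
  | empty => simp
  | @insert v T hv _ ih =>
    refine le_trans ?_ (height_labelIdeal_add_two_le hv fun u _ huv => huv)
    rw [Set.ncard_insert_of_notMem hv, mul_add_one, Nat.cast_add]
    gcongr
    rfl

open Classical in
lemma IsRooted.update_self (hℓ : IsRooted ℓ T) (hv : ℓ v ≠ v) :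
    IsRooted (Function.update ℓ v v) T := by
  intro u hu
  have hroot := hℓ u hu
  have hne : ℓ u ≠ v := fun huv => hv (by rw [huv] at hroot; exact hroot.2)
  by_cases huv : u = v
  · subst huv
    simp [hu]
  · simp [Function.update_of_ne huv, Function.update_of_ne hne, hroot]

open Classical in
lemma IsRooted.labelIdeal_update_self_lt (hℓ : IsRooted ℓ T) (hvT : v ∉ T) (hv : ℓ v ≠ v) :
    labelIdeal K (Function.update ℓ v v) T < labelIdeal K ℓ T := by
  have hcoarser : ∀ u ∉ T, ℓ (Function.update ℓ v v u) = ℓ u := by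
    intro u hu
    by_cases huv : u = v
    · rw [huv, Function.update_self]
    · rw [Function.update_of_ne huv, (hℓ u hu).2]
  refine lt_of_le_not_ge (labelIdeal_le_labelIdeal_iff.2 ⟨subset_rfl, fun i hi j hj hij => ?_⟩)
    fun hge => hv ?_
  · rw [← hcoarser i hi, hij, hcoarser j hj]
  · have heq := (labelIdeal_le_labelIdeal_iff.1 hge).2 (ℓ v) (hℓ v hvT).1 v hvT (hℓ v hvT).2
    rwa [Function.update_of_ne hv, Function.update_self, (hℓ v hvT).2] at heq

lemma IsRooted.le_height_labelIdeal [Finite V] (hℓ : IsRooted ℓ T) :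
    ((2 * T.ncard + {v | v ∉ T ∧ ℓ v ≠ v}.ncard : ℕ) : ℕ∞) ≤ (labelIdeal K ℓ T).height := by
  classical
  induction hn : {v | v ∉ T ∧ ℓ v ≠ v}.ncard generalizing ℓ with
  | zero =>
    refine (two_mul_ncard_le_height_labelIdeal_id T).trans (Ideal.height_mono ?_)
    exact labelIdeal_le_labelIdeal_iff.2 ⟨subset_rfl, fun i _ j _ hij => congrArg ℓ hij⟩
  | succ n ih =>
    obtain ⟨v, hvT, hv⟩ := Set.nonempty_of_ncard_ne_zero (hn.trans_ne n.succ_ne_zero)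
    set ℓ' := Function.update ℓ v v with hℓ'
    have hcard : {u | u ∉ T ∧ ℓ' u ≠ u}.ncard = n := by
      have heq : {u | u ∉ T ∧ ℓ' u ≠ u} = {u | u ∉ T ∧ ℓ u ≠ u} \ {v} := by
        ext u
        by_cases huv : u = v <;> simp [hℓ', huv]
      rw [heq, Set.ncard_sdiff_singleton_of_mem (show v ∈ {u | u ∉ T ∧ ℓ u ≠ u} from ⟨hvT, hv⟩),
        hn, Nat.add_sub_cancel]
    have hlt : labelIdeal K ℓ' T < labelIdeal K ℓ T := hℓ.labelIdeal_update_self_lt hvT hv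
    calc ((2 * T.ncard + (n + 1) : ℕ) : ℕ∞) = (2 * T.ncard + n : ℕ) + 1 := by push_cast; ring
      _ ≤ (labelIdeal K ℓ' T).height + 1 := by
          gcongr
          exact ih (hℓ.update_self hv) hcard
      _ ≤ (labelIdeal K ℓ T).height := Ideal.height_add_one_le_of_lt_of_isPrime hlt

lemma IsRooted.height_labelIdeal_le [Finite V] (hℓ : IsRooted ℓ T) :
    (labelIdeal K ℓ T).height ≤ ((2 * T.ncard + {v | v ∉ T ∧ ℓ v ≠ v}.ncard : ℕ) : ℕ∞) := by
  let S : Set (MvPolynomial (V ⊕ V) K) :=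
    ((fun v => X (Sum.inl v)) '' T ∪ (fun v => X (Sum.inr v)) '' T) ∪
      (fun v => edgeBinomial K v (ℓ v)) '' {v | v ∉ T ∧ ℓ v ≠ v}
  have hcard : S.ncard ≤ 2 * T.ncard + {v | v ∉ T ∧ ℓ v ≠ v}.ncard := by
    refine (Set.ncard_union_le _ _).trans (add_le_add ?_ (Set.ncard_image_le (Set.toFinite _)))
    rw [two_mul]
    exact (Set.ncard_union_le _ _).trans
      (add_le_add (Set.ncard_image_le (Set.toFinite _)) (Set.ncard_image_le (Set.toFinite _)))
  suffices hmin : labelIdeal K ℓ T ∈ (Ideal.span S).minimalPrimes from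
    (Ideal.height_le_card_of_mem_minimalPrimes_span (Set.toFinite _) hmin).trans
      (Nat.cast_le.2 hcard)
  refine ⟨⟨inferInstance, Ideal.span_le.2 ?_⟩, ?_⟩
  · rintro f ((⟨v, hv, rfl⟩ | ⟨v, hv, rfl⟩) | ⟨v, hv, rfl⟩)
    · exact X_inl_mem_labelIdeal.2 hv
    · exact X_inr_mem_labelIdeal.2 hv
    · exact edgeBinomial_mem_labelIdeal.2 (Or.inr (Or.inr (hℓ v hv.1).2.symm))
  · rintro Q ⟨hQ, hSQ⟩ hle
    have hroot : ∀ v ∉ T, edgeBinomial K v (ℓ v) ∈ Q := by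
      intro v hv
      by_cases hvℓ : ℓ v = v
      · rw [hvℓ, edgeBinomial_self]
        exact Q.zero_mem
      · exact hSQ (Ideal.subset_span (Or.inr ⟨v, ⟨hv, hvℓ⟩, rfl⟩))
    refine labelIdeal_le (fun v hv => ⟨hSQ (Ideal.subset_span (Or.inl (Or.inl ⟨v, hv, rfl⟩))),
      hSQ (Ideal.subset_span (Or.inl (Or.inr ⟨v, hv, rfl⟩)))⟩) fun i hi j hj hij => ?_
    refine edgeBinomial_mem_trans (k := ℓ i)
      (fun h => (hℓ i hi).1 (X_inl_mem_labelIdeal.1 (hle h.1))) (hroot i hi) ?_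
    rw [hij, ← neg_edgeBinomial]
    exact Q.neg_mem (hroot j hj)

lemma IsRooted.height_labelIdeal [Finite V] (hℓ : IsRooted ℓ T) :
    (labelIdeal K ℓ T).height = ((2 * T.ncard + {v | v ∉ T ∧ ℓ v ≠ v}.ncard : ℕ) : ℕ∞) :=
  le_antisymm hℓ.height_labelIdeal_le hℓ.le_height_labelIdeal

end Height

section Unmixed

open MvPolynomial

variable {V K : Type*} [Field K] {G : SimpleGraph V} {S T : Set V} {i j v : V}

open Classical in
/-- A chosen vertex of the component of `v` in `G ∖ T`; the junk value at `v ∈ T` is `v`. -/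
noncomputable def componentLabel (G : SimpleGraph V) (T : Set V) (v : V) : V :=
  if h : v ∈ Tᶜ then ((deleteSet G T).connectedComponentMk ⟨v, h⟩).out.1 else v

lemma componentLabel_notMem (hv : v ∉ T) : componentLabel G T v ∉ T := by
  rw [componentLabel, dif_pos (show v ∈ Tᶜ from hv)]
  exact ((deleteSet G T).connectedComponentMk ⟨v, hv⟩).out.2

lemma not_separated_componentLabel (hv : v ∉ T) : ¬ Separated G T v (componentLabel G T v) := by
  rw [componentLabel, dif_pos (show v ∈ Tᶜ from hv),
    ← connectedComponentMk_eq_iff (a := ⟨v, hv⟩)]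
  exact (Quot.out_eq _).symm

lemma componentLabel_eq_iff (hi : i ∉ T) (hj : j ∉ T) :
    componentLabel G T i = componentLabel G T j ↔ ¬ Separated G T i j := by
  constructor
  · intro h hs
    rcases hs.or_of_notMem (componentLabel_notMem hi) with hs' | hs'
    · exact not_separated_componentLabel hi hs'
    · exact not_separated_componentLabel hj (h ▸ hs'.symm)
  · intro h
    rw [componentLabel, componentLabel, dif_pos (show i ∈ Tᶜ from hi),
      dif_pos (show j ∈ Tᶜ from hj),
      connectedComponentMk_eq_iff (a := ⟨i, hi⟩) (b := ⟨j, hj⟩).2 h]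

lemma isRooted_componentLabel : IsRooted (componentLabel G T) T := fun _ hv =>
  ⟨componentLabel_notMem hv, (componentLabel_eq_iff (componentLabel_notMem hv) hv).2
    fun h => not_separated_componentLabel hv h.symm⟩

lemma isTransversal_setOf_componentLabel_eq_self :
    IsTransversal G T {v | v ∉ T ∧ componentLabel G T v = v} where
  notMem _ hv := hv.1
  pairwise v hv w hw hne := by
    by_contra hs
    rw [← componentLabel_eq_iff hv.1 hw.1, hv.2, hw.2] at hs
    exact hne hs
  exists_not_separated y hy := ⟨componentLabel G T y, isRooted_componentLabel y hy,
    fun h => not_separated_componentLabel hy h.symm⟩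

/-- The prime ideal `P_T(G)`: the smallest prime ideal containing the variables of the vertices in
`T` and the binomials of all pairs of vertices in a common component of `G ∖ T`. -/
noncomputable def cutIdeal (K : Type*) [Field K] (G : SimpleGraph V) (T : Set V) :
    Ideal (MvPolynomial (V ⊕ V) K) :=
  labelIdeal K (componentLabel G T) T

instance cutIdeal_isPrime : (cutIdeal K G T).IsPrime := labelIdeal_isPrime

lemma edgeBinomial_mem_cutIdeal : edgeBinomial K i j ∈ cutIdeal K G T ↔ ¬ Separated G T i j := by
  rw [cutIdeal, edgeBinomial_mem_labelIdeal]
  by_cases hi : i ∈ T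
  · simp [hi, Separated]
  by_cases hj : j ∈ T
  · simp [hj, Separated]
  simp [hi, hj, componentLabel_eq_iff]

lemma cutIdeal_le_cutIdeal_iff : cutIdeal K G S ≤ cutIdeal K G T ↔
    S ⊆ T ∧ ∀ i j, Separated G T i j → Separated G S i j := by
  rw [cutIdeal, cutIdeal, labelIdeal_le_labelIdeal_iff]
  refine and_congr_right fun hST => ⟨fun h i j hs => ?_, fun h i hi j hj => ?_⟩
  · have hij := h i hs.1 j hs.2.1
    rw [componentLabel_eq_iff hs.1 hs.2.1,
      componentLabel_eq_iff (fun h => hs.1 (hST h)) fun h => hs.2.1 (hST h)] at hij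
    exact by_contra fun hs' => hij hs' hs
  · rw [componentLabel_eq_iff hi hj,
      componentLabel_eq_iff (fun h => hi (hST h)) fun h => hj (hST h)]
    exact mt (h i j)

lemma binomialEdgeIdeal_le_iff {I : Ideal (MvPolynomial (V ⊕ V) K)} :
    binomialEdgeIdeal K G ≤ I ↔ ∀ i j, G.Adj i j → edgeBinomial K i j ∈ I := by
  rw [binomialEdgeIdeal, Ideal.span_le]
  constructor
  · intro h i j hij
    exact h ⟨i, j, hij, rfl⟩
  · rintro h f ⟨i, j, hij, rfl⟩
    exact h i j hij

lemma binomialEdgeIdeal_le_cutIdeal : binomialEdgeIdeal K G ≤ cutIdeal K G T :=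
  binomialEdgeIdeal_le_iff.2 fun _ _ hij => edgeBinomial_mem_cutIdeal.2 fun h => h.not_adj hij

lemma exists_cutIdeal_le {Q : Ideal (MvPolynomial (V ⊕ V) K)} [Q.IsPrime]
    (h : binomialEdgeIdeal K G ≤ Q) : ∃ T, cutIdeal K G T ≤ Q := by
  rw [binomialEdgeIdeal_le_iff] at h
  refine ⟨{v | X (Sum.inl v) ∈ Q ∧ X (Sum.inr v) ∈ Q},
    labelIdeal_le (fun v hv => hv) fun i hi j hj hij => ?_⟩
  rw [componentLabel_eq_iff hi hj] at hij
  by_contra hmem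
  refine hij ⟨hi, hj, {k | edgeBinomial K i k ∈ Q}, fun k l hkl hk _ hik => ?_, ?_, hmem⟩
  · exact edgeBinomial_mem_trans hk hik (h k l hkl)
  · rw [Set.mem_ofPred_eq, edgeBinomial_self]
    exact Q.zero_mem

lemma IsCutset.eq_of_cutIdeal_le [Finite V] (hT : IsCutset G T)
    (h : cutIdeal K G S ≤ cutIdeal K G T) : S = T := by
  obtain ⟨hST, hsep⟩ := cutIdeal_le_cutIdeal_iff.1 h
  refine hST.antisymm fun t ht => ?_
  by_contra htS
  obtain ⟨b₁, b₂, h₁, h₂, hs⟩ := isCutset_iff.1 hT t ht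
  rcases (hsep b₁ b₂ hs).or_of_notMem htS with hs' | hs'
  · exact hs'.not_adj h₁.symm
  · exact hs'.not_adj h₂

lemma cutIdeal_mem_minimalPrimes [Finite V] (hT : IsCutset G T) :
    cutIdeal K G T ∈ (binomialEdgeIdeal K G).minimalPrimes := by
  refine ⟨⟨cutIdeal_isPrime, binomialEdgeIdeal_le_cutIdeal⟩, ?_⟩
  rintro Q ⟨hQ, hQle⟩ hQT
  obtain ⟨S, hS⟩ := exists_cutIdeal_le hQle
  exact hT.eq_of_cutIdeal_le (hS.trans hQT) ▸ hS

lemma exists_isCutset_of_mem_minimalPrimes [Finite V] {P : Ideal (MvPolynomial (V ⊕ V) K)}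
    (hP : P ∈ (binomialEdgeIdeal K G).minimalPrimes) :
    ∃ T, IsCutset G T ∧ cutIdeal K G T = P := by
  obtain ⟨⟨hprime, hle⟩, hmin⟩ := hP
  have hge : ∀ T, cutIdeal K G T ≤ P → P ≤ cutIdeal K G T :=
    fun T hT => hmin ⟨cutIdeal_isPrime, binomialEdgeIdeal_le_cutIdeal⟩ hT
  obtain ⟨T, hT⟩ := exists_cutIdeal_le hle
  refine ⟨T, isCutset_iff.2 fun t ht => ?_, hT.antisymm (hge T hT)⟩
  by_contra! hnbr
  have hsub : cutIdeal K G (T \ {t}) ≤ cutIdeal K G T := cutIdeal_le_cutIdeal_iff.2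
    ⟨Set.sdiff_subset, fun i j hs => hs.sdiff_singleton ht hnbr⟩
  exact ((cutIdeal_le_cutIdeal_iff.1 (hT.trans (hge _ (hsub.trans hT)))).1 ht).2 rfl

lemma exists_height_cutIdeal_eq [Finite V] (G : SimpleGraph V) (T : Set V) :
    ∃ n : ℕ, (cutIdeal K G T).height = n ∧ n + numComponents G T = Nat.card V + T.ncard := by
  refine ⟨_, isRooted_componentLabel.height_labelIdeal, ?_⟩
  rw [← isTransversal_setOf_componentLabel_eq_self.ncard_eq]
  have hroots : {v | v ∉ T ∧ componentLabel G T v ≠ v}.ncard +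
      {v | v ∉ T ∧ componentLabel G T v = v}.ncard = Tᶜ.ncard := by
    rw [← Set.ncard_union_eq (by grind)]
    congr 1
    ext v
    grind
  have hcompl := Set.ncard_add_ncard_compl T
  omega

theorem isUnmixed_binomialEdgeIdeal_iff [Finite V] :
    IsUnmixed (binomialEdgeIdeal K G) ↔
      ∀ T, IsCutset G T → numComponents G T = T.ncard + numComponents G ∅ := by
  choose n hn hcard using exists_height_cutIdeal_eq (K := K) G
  have hempty := hcard ∅
  rw [Set.ncard_empty] at hempty
  constructor
  · intro h T hT
    have heq := h _ (cutIdeal_mem_minimalPrimes hT) _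
      (cutIdeal_mem_minimalPrimes (T := ∅) fun _ ht => ht.elim)
    rw [hn, hn, Nat.cast_inj] at heq
    have := hcard T
    omega
  · intro h P hP Q hQ
    obtain ⟨T, hT, rfl⟩ := exists_isCutset_of_mem_minimalPrimes hP
    obtain ⟨S, hS, rfl⟩ := exists_isCutset_of_mem_minimalPrimes hQ
    rw [hn, hn, Nat.cast_inj]
    have hTcard := hcard T
    have hScard := hcard S
    rw [h T hT] at hTcard
    rw [h S hS] at hScard
    omega

end Unmixed

section Deletion

variable {V K : Type*} [Field K] {G : SimpleGraph V} {S : Set V} {T : Set ↥Sᶜ} {v : V}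

lemma numComponents_deleteSet :
    numComponents (deleteSet G S) T = numComponents G (S ∪ Subtype.val '' T) := by
  have hmem : ∀ x : ↥Sᶜ, x ∈ Tᶜ ↔ (x : V) ∉ S ∪ Subtype.val '' T := by
    simp +contextual
  exact Nat.card_congr (SimpleGraph.Iso.connectedComponentEquiv
    ⟨⟨fun x => ⟨x.1, (hmem x.1).1 x.2⟩,
      fun x => ⟨⟨x, fun h => x.2 (Or.inl h)⟩, (hmem _).2 x.2⟩, fun _ => rfl, fun _ => rfl⟩,
      Iff.rfl⟩)

lemma isCutset_deleteSet_iff : IsCutset (deleteSet G S) T ↔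
    ∀ t ∈ Subtype.val '' T, numComponents G ((S ∪ Subtype.val '' T) \ {t}) <
      numComponents G (S ∪ Subtype.val '' T) := by
  rw [Set.forall_mem_image]
  refine forall₂_congr fun t _ => ?_
  rw [numComponents_deleteSet, numComponents_deleteSet, Set.image_sdiff Subtype.val_injective,
    Set.image_singleton, Set.union_sdiff_distrib, Set.sdiff_singleton_eq_self t.2]

lemma isUnmixed_deleteSet_singleton [Finite V] (hG : IsUnmixed (binomialEdgeIdeal K G))
    (hv : IsCutVertex G v)
    (hinsert : ∀ T, v ∉ T →
      (∀ t ∈ T, numComponents G (insert v T \ {t}) < numComponents G (insert v T)) →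
      IsCutset G (insert v T)) :
    IsUnmixed (binomialEdgeIdeal K (deleteSet G {v})) := by
  rw [isUnmixed_binomialEdgeIdeal_iff] at hG ⊢
  have hsingle : IsCutset G {v} := by
    rintro _ rfl
    exact isCutVertex_iff_numComponents_lt.1 hv
  intro T hT
  have hvT : v ∉ Subtype.val '' T := by simp
  rw [isCutset_deleteSet_iff, Set.singleton_union] at hT
  have hcard := hG _ (hinsert _ hvT hT)
  rw [Set.ncard_insert_of_notMem hvT, Set.ncard_image_of_injective _ Subtype.val_injective] at hcard
  rw [numComponents_deleteSet, numComponents_deleteSet, Set.image_empty, Set.union_empty,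
    Set.singleton_union, hcard, hG _ hsingle, Set.ncard_singleton, add_assoc]

end Deletion

section Whiskers

variable {V K : Type*} [Field K] {B : SimpleGraph V} {W T L : Set V} {a b t w : V}

lemma withWhiskers_adj_inl_inr {w : W} :
    (withWhiskers B W).Adj (Sum.inl a) (Sum.inr w) ↔ a = w := Iff.rfl

lemma withWhiskers_adj_inr_iff {w : W} {z : V ⊕ W} :
    (withWhiskers B W).Adj (Sum.inr w) z ↔ z = Sum.inl w.1 := by
  rcases z with z | z
  · exact Sum.inl_injective.eq_iff.symm
  · exact ⟨fun h => h.elim, fun h => by cases h⟩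

lemma exists_eq_inl_of_withWhiskers_adj (ht : t ∉ W) {z : V ⊕ W}
    (h : (withWhiskers B W).Adj (Sum.inl t) z) : ∃ b, z = Sum.inl b ∧ B.Adj t b := by
  rcases z with b | w
  · exact ⟨b, rfl, h⟩
  · exact absurd (withWhiskers_adj_inl_inr.1 h ▸ w.2) ht

lemma separated_withWhiskers_inr {T : Set (V ⊕ W)} {w : W} (hw : Sum.inl w.1 ∈ T)
    (hwT : Sum.inr w ∉ T) {z : V ⊕ W} (hz : z ∉ T) (hzw : z ≠ Sum.inr w) :
    Separated (withWhiskers B W) T (Sum.inr w) z := by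
  refine ⟨hwT, hz, {Sum.inr w}, ?_, rfl, hzw⟩
  rintro _ y hxy - hy rfl
  exact absurd (withWhiskers_adj_inr_iff.1 hxy ▸ hw) hy

lemma separated_withWhiskers_inl_iff :
    Separated (withWhiskers B W) (Sum.inl '' T) (Sum.inl a) (Sum.inl b) ↔ Separated B T a b := by
  constructor
  · rintro ⟨ha, hb, K, hK, haK, hbK⟩
    rw [Sum.inl_injective.mem_set_image] at ha hb
    refine ⟨ha, hb, Sum.inl ⁻¹' K, fun x y hxy hx hy hxK => ?_, haK, hbK⟩
    exact hK (x := Sum.inl x) (y := Sum.inl y) hxy (by simpa using hx) (by simpa using hy) hxK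
  · rintro ⟨ha, hb, K, hK, haK, hbK⟩
    refine ⟨by simpa using ha, by simpa using hb, {z | Sum.elim id Subtype.val z ∈ K}, ?_,
      haK, hbK⟩
    rintro (x | w) (y | w') hxy hx hy hxK
    · exact hK hxy (by simpa using hx) (by simpa using hy) hxK
    · exact (withWhiskers_adj_inl_inr.1 hxy ▸ hxK : w'.1 ∈ K)
    · exact (Sum.inl_injective (withWhiskers_adj_inr_iff.1 hxy) ▸ hxK : y ∈ K)
    · exact hxy.elim

lemma exists_separated_withWhiskers_iff (ht : t ∈ T) :
    (∃ z₁ z₂, (withWhiskers B W).Adj (Sum.inl t) z₁ ∧ (withWhiskers B W).Adj (Sum.inl t) z₂ ∧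
      Separated (withWhiskers B W) (Sum.inl '' T) z₁ z₂) ↔ IsWhiskerCutAt B W T t := by
  constructor
  · rintro ⟨z₁, z₂, h₁, h₂, hs⟩
    refine ⟨fun _ => ?_, fun htW => ?_⟩
    · rcases z₁ with b | w₁
      · exact ⟨b, fun hb => hs.1 ⟨b, hb, rfl⟩, h₁⟩
      rcases z₂ with b | w₂
      · exact ⟨b, fun hb => hs.2.1 ⟨b, hb, rfl⟩, h₂⟩
      · exact absurd (congrArg Sum.inr (Subtype.ext
          ((withWhiskers_adj_inl_inr.1 h₁).symm.trans (withWhiskers_adj_inl_inr.1 h₂)))) hs.ne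
    · obtain ⟨b₁, rfl, hb₁⟩ := exists_eq_inl_of_withWhiskers_adj htW h₁
      obtain ⟨b₂, rfl, hb₂⟩ := exists_eq_inl_of_withWhiskers_adj htW h₂
      exact ⟨b₁, b₂, hb₁, hb₂, separated_withWhiskers_inl_iff.1 hs⟩
  · intro h
    by_cases htW : t ∈ W
    · obtain ⟨b, hb, htb⟩ := h.1 htW
      exact ⟨Sum.inr ⟨t, htW⟩, Sum.inl b, rfl, htb, separated_withWhiskers_inr
        (Set.mem_image_of_mem _ ht) (by simp) (by simpa using hb) (by simp)⟩
    · obtain ⟨b₁, b₂, hb₁, hb₂, hs⟩ := h.2 htW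
      exact ⟨Sum.inl b₁, Sum.inl b₂, hb₁, hb₂, separated_withWhiskers_inl_iff.2 hs⟩

lemma not_separated_of_withWhiskers_adj_inr {T : Set (V ⊕ W)} {w : W} {z₁ z₂ : V ⊕ W}
    (h₁ : (withWhiskers B W).Adj (Sum.inr w) z₁) (h₂ : (withWhiskers B W).Adj (Sum.inr w) z₂) :
    ¬ Separated (withWhiskers B W) T z₁ z₂ := fun hs =>
  hs.ne ((withWhiskers_adj_inr_iff.1 h₁).trans (withWhiskers_adj_inr_iff.1 h₂).symm)

lemma isCutset_withWhiskers_iff [Finite V] :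
    IsCutset (withWhiskers B W) (Sum.inl '' T) ↔ IsWhiskerCutset B W T := by
  rw [isCutset_iff, Set.forall_mem_image]
  exact forall₂_congr fun _ ht => exists_separated_withWhiskers_iff ht

lemma isCutVertex_withWhiskers_inl_iff [Finite V] :
    IsCutVertex (withWhiskers B W) (Sum.inl t) ↔ IsWhiskerCutAt B W {t} t := by
  rw [isCutVertex_iff, ← exists_separated_withWhiskers_iff (Set.mem_singleton t),
    Set.image_singleton]

lemma IsTransversal.withWhiskers (hL : IsTransversal B T L) :
    IsTransversal (withWhiskers B W) (Sum.inl '' T)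
      (Sum.inl '' L ∪ Sum.inr '' (Subtype.val ⁻¹' T)) where
  notMem := by
    rintro _ (⟨x, hx, rfl⟩ | ⟨w, -, rfl⟩)
    · simpa using hL.notMem x hx
    · simp
  pairwise := by
    have hmem : ∀ w : W, w.1 ∈ T → Sum.inl w.1 ∈ (Sum.inl '' T : Set (V ⊕ W)) :=
      fun _ hw => Set.mem_image_of_mem _ hw
    rintro _ (⟨x, hx, rfl⟩ | ⟨w, hw, rfl⟩) _ (⟨y, hy, rfl⟩ | ⟨w', hw', rfl⟩) hne
    · exact separated_withWhiskers_inl_iff.2 (hL.pairwise hx hy fun h => hne (congrArg _ h))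
    · exact (separated_withWhiskers_inr (hmem w' hw') (by simp)
        (by simpa using hL.notMem x hx) hne).symm
    · exact separated_withWhiskers_inr (hmem w hw) (by simp)
        (by simpa using hL.notMem y hy) hne.symm
    · exact separated_withWhiskers_inr (hmem w hw) (by simp) (by simp) hne.symm
  exists_not_separated := by
    rintro (y | w) hy
    · obtain ⟨x, hx, hxy⟩ := hL.exists_not_separated y fun h => hy ⟨y, h, rfl⟩
      exact ⟨Sum.inl x, Or.inl ⟨x, hx, rfl⟩, mt separated_withWhiskers_inl_iff.1 hxy⟩
    by_cases hw : w.1 ∈ T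
    · exact ⟨Sum.inr w, Or.inr ⟨w, hw, rfl⟩, not_separated_self⟩
    obtain ⟨x, hx, hxw⟩ := hL.exists_not_separated w hw
    refine ⟨Sum.inl x, Or.inl ⟨x, hx, rfl⟩, fun hs => ?_⟩
    rcases hs.or_of_notMem (c := Sum.inl w.1) (by simpa using hw) with hs' | hs'
    · exact hxw (separated_withWhiskers_inl_iff.1 hs')
    · exact hs'.not_adj (withWhiskers_adj_inl_inr.2 rfl)

lemma numComponents_withWhiskers [Finite V] (B : SimpleGraph V) (W T : Set V) :
    numComponents (withWhiskers B W) (Sum.inl '' T) = numComponents B T + (W ∩ T).ncard := by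
  obtain ⟨L, hL⟩ := exists_isTransversal B T
  rw [← hL.ncard_eq, ← (hL.withWhiskers (W := W)).ncard_eq, Set.ncard_union_eq (by simp),
    Set.ncard_image_of_injective _ Sum.inl_injective,
    Set.ncard_image_of_injective _ Sum.inr_injective,
    ← Subtype.image_preimage_coe, Set.ncard_image_of_injective _ Subtype.val_injective]

lemma isAccessibleBlock_of_isAccessible [Finite V] (hconn : B.Connected)
    (hcut : ∀ v, ¬ IsCutVertex B v) (hacc : IsAccessible K (withWhiskers B W)) :
    IsAccessibleBlock B W where
  not_separated_empty a b h := by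
    have := h.two_le_numComponents
    rw [numComponents_empty_of_connected hconn] at this
    omega
  not_separated_singleton v a b h := by
    refine hcut v (isCutVertex_iff_numComponents_lt.2 ?_)
    rw [sdiff_self, Set.bot_eq_empty, numComponents_empty_of_connected hconn]
    exact h.two_le_numComponents
  numComponents_eq T hT := by
    have hT' := isUnmixed_binomialEdgeIdeal_iff.1 hacc.1 _ (isCutset_withWhiskers_iff.2 hT)
    have hempty := numComponents_withWhiskers B W ∅
    rw [Set.image_empty, Set.inter_empty, Set.ncard_empty,
      numComponents_empty_of_connected hconn] at hempty
    rw [numComponents_withWhiskers, hempty, Set.inter_comm,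
      Set.ncard_image_of_injective _ Sum.inl_injective] at hT'
    have := Set.ncard_inter_add_ncard_sdiff_eq_ncard T W
    omega
  exists_isWhiskerCutset_sdiff T hT hne := by
    obtain ⟨_, ⟨t, ht, rfl⟩, hc⟩ := hacc.2 _ (isCutset_withWhiskers_iff.2 hT) (hne.image _)
    rw [← Set.image_singleton, ← Set.image_sdiff Sum.inl_injective] at hc
    exact ⟨t, ht, isCutset_withWhiskers_iff.1 hc⟩

lemma IsAccessibleBlock.isCutVertex_withWhiskers_inl [Finite V] (h : IsAccessibleBlock B W)
    (hW : W.Nontrivial) (hw : w ∈ W) : IsCutVertex (withWhiskers B W) (Sum.inl w) := by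
  obtain ⟨b, -, hwb⟩ := h.exists_adj_mem hW w
  exact isCutVertex_withWhiskers_inl_iff.2 (isWhiskerCutAt_of_mem hw hwb.ne' hwb)

lemma IsAccessibleBlock.setOf_isCutVertex_subset [Finite V] (h : IsAccessibleBlock B W) :
    {v | IsCutVertex (withWhiskers B W) v} ⊆ Sum.inl '' W := by
  rintro (x | w) hv
  · refine ⟨x, by_contra fun hx => ?_, rfl⟩
    obtain ⟨b₁, b₂, -, -, hs⟩ := (isCutVertex_withWhiskers_inl_iff.1 hv).2 hx
    exact h.not_separated_singleton _ _ _ hs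
  · obtain ⟨z₁, z₂, h₁, h₂, hs⟩ := isCutVertex_iff.1 hv
    exact absurd hs (not_separated_of_withWhiskers_adj_inr h₁ h₂)

lemma IsAccessibleBlock.ncard_eq_ncard_setOf_isCutVertex [Finite V] (h : IsAccessibleBlock B W)
    (hcut : {v | IsCutVertex (withWhiskers B W) v}.Nontrivial) :
    W.ncard = {v | IsCutVertex (withWhiskers B W) v}.ncard := by
  have hW : W.Nontrivial :=
    (Set.image_nontrivial Sum.inl_injective).1 (hcut.mono h.setOf_isCutVertex_subset)
  have heq : {v | IsCutVertex (withWhiskers B W) v} = Sum.inl '' W :=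
    h.setOf_isCutVertex_subset.antisymm
      (Set.image_subset_iff.2 fun _ hw => h.isCutVertex_withWhiskers_inl hW hw)
  rw [heq, Set.ncard_image_of_injective _ Sum.inl_injective]

lemma isUnmixed_deleteSet_withWhiskers [Finite V]
    (hunmixed : IsUnmixed (binomialEdgeIdeal K (withWhiskers B W))) (hw : w ∈ W)
    (hcut : IsCutVertex (withWhiskers B W) (Sum.inl w)) (hobs : ∀ T, ¬ IsObstruction B W w T) :
    IsUnmixed (binomialEdgeIdeal K (deleteSet (withWhiskers B W) {Sum.inl w})) := by
  refine isUnmixed_deleteSet_singleton hunmixed hcut fun T hwT hdrop => ?_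
  have hsep : ∀ t ∈ T, ∃ z₁ z₂, (withWhiskers B W).Adj t z₁ ∧ (withWhiskers B W).Adj t z₂ ∧
      Separated (withWhiskers B W) (insert (Sum.inl w) T) z₁ z₂ :=
    fun t ht => (numComponents_sdiff_lt_iff (Set.mem_insert_of_mem _ ht)).1 (hdrop t ht)
  obtain ⟨S, rfl⟩ : ∃ S, T = Sum.inl '' S := by
    refine ⟨Sum.inl ⁻¹' T, (Set.image_preimage_eq_of_subset ?_).symm⟩
    rintro (x | f) hz
    · exact ⟨x, rfl⟩
    · obtain ⟨z₁, z₂, h₁, h₂, hs⟩ := hsep _ hz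
      exact absurd hs (not_separated_of_withWhiskers_adj_inr h₁ h₂)
  rw [Sum.inl_injective.mem_set_image] at hwT
  rw [← Set.image_insert_eq] at hsep ⊢
  have hS : ∀ t ∈ S, IsWhiskerCutAt B W (insert w S) t := fun t ht =>
    (exists_separated_withWhiskers_iff (Set.mem_insert_of_mem _ ht)).1 (hsep _ ⟨t, ht, rfl⟩)
  obtain ⟨b, hwb, hbS⟩ := Set.not_subset.1 fun hsub => hobs S ⟨hwT, hsub, hS⟩
  refine isCutset_withWhiskers_iff.2 (Set.forall_mem_insert.2 ⟨?_, hS⟩)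
  exact isWhiskerCutAt_of_mem hw (by simp [hbS, SimpleGraph.Adj.ne' hwb]) hwb

end Whiskers

end BinomialEdge

theorem mainTheorem8_general (K : Type*) [Field K] {V : Type*} [Finite V] (B : SimpleGraph V)
    (hconn : B.Connected) (hB : ∀ v, ¬ BinomialEdge.IsCutVertex B v) (W : Set V)
    (hacc : BinomialEdge.IsAccessible K (BinomialEdge.withWhiskers B W))
    (hcut : {v | BinomialEdge.IsCutVertex (BinomialEdge.withWhiskers B W) v}.ncard = 3) :
    ∃ v, BinomialEdge.IsCutVertex (BinomialEdge.withWhiskers B W) v ∧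
      BinomialEdge.IsUnmixed (BinomialEdge.binomialEdgeIdeal K
        (BinomialEdge.deleteSet (BinomialEdge.withWhiskers B W) {v})) := by
  have hblock := BinomialEdge.isAccessibleBlock_of_isAccessible hconn hB hacc
  have hW : W.ncard = 3 := by
    rw [hblock.ncard_eq_ncard_setOf_isCutVertex (Set.one_lt_ncard_iff_nontrivial.1 (by omega)),
      hcut]
  obtain ⟨w, hw, hobs⟩ := hblock.exists_forall_not_isObstruction hW
  have hwcut : BinomialEdge.IsCutVertex (BinomialEdge.withWhiskers B W) (Sum.inl w) :=
    hblock.isCutVertex_withWhiskers_inl (Set.one_lt_ncard_iff_nontrivial.1 (by omega)) hw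
  exact ⟨Sum.inl w, hwcut,
    BinomialEdge.isUnmixed_deleteSet_withWhiskers hacc.1 hw hwcut hobs⟩

theorem mainTheorem8 (K : Type*) [Field K] {V : Type*} [Finite V] (G : SimpleGraph V)
    (S : Set V) (hS : BinomialEdge.IsBlock G S) (W : Set ↥S)
    (hacc : BinomialEdge.IsAccessible K (BinomialEdge.withWhiskers (G.induce S) W))
    (hcut : {v | BinomialEdge.IsCutVertex
      (BinomialEdge.withWhiskers (G.induce S) W) v}.ncard = 3) :
    ∃ v, BinomialEdge.IsCutVertex (BinomialEdge.withWhiskers (G.induce S) W) v ∧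
      BinomialEdge.IsUnmixed (BinomialEdge.binomialEdgeIdeal K
        (BinomialEdge.deleteSet (BinomialEdge.withWhiskers (G.induce S) W) {v})) :=
  mainTheorem8_general K (G.induce S) hS.prop.1 hS.prop.2 W hacc hcut
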